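/- Let $n\in\mathbb N$, $\mathcal M=\{1,\dots,n\}$, and let $\mathcal H$ be a two-dimensional complex Hilbert space. *Ensembles and cost.* An ensemble is a family $\rho(1),\dots,\rho(n)\ge 0$ of operators on $\mathcal H$ with $\sum_m\operatorname{Tr}\rho(m)=1$. A function $\gamma:\{1,\dots,n\}\to\mathbb R$ with average $\overline\gamma$ is balanced if $\frac12(\gamma+\gamma\circ\sigma^{-1})=\overline\gamma$ for some permutation $\sigma$. *Guesswork.* A numbering is a bijection $\mathbf n:\{1,\dots,n\}\to\mathcal M$. A numbering-valued measurement $\pi$ is a family of positive operators $\pi(\mathbf n)$ on $\mathcal H$, indexed by all numberings, with $\sum_{\mathbf n}\pi(\mathbf n)=1$. Its guesswork is $G^\gamma(\rho,\pi)=\sum_{t}\gamma(t)\sum_{\mathbf n}\operatorname{Tr}[\pi(\mathbf n)\rho(\mathbf n(t))]$. A sequential-instrument strategy consists of finite-dimensional Hilbert spaces $\mathcal H_0=\mathcal H,\mathcal H_1,\dots,\mathcal H_n$ and instruments $\iota_t$, $1\le t\le n$: for each $t$, a family $(\iota_t(m))_{m\in\mathcal M}$ of completely positive maps from operators on $\mathcal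 H_{t-1}$ to operators on $\mathcal H_t$ whose sum over $m$ is trace preserving. The probability that its $t$-th query is the (first) correct one is $$q(t)=\sum_{(m_1,\dots,m_t)\in\mathcal M^t,\ m_t\notin\{m_1,\dots,m_{t-1}\}}\operatorname{Tr}\big[\iota_t(m_t)\circ\cdots\circ\iota_1(m_1)\,(\rho(m_t))\big].$$ The minimum guesswork $G^\gamma_{\min}(\rho)$ is the minimum of $\sum_t\gamma(t)q(t)$ over all sequential-instrument strategies that surely reach the correct query, i.e. for which $\sum_{t=1}^n q(t)=1$. *The measurement.* Put $E(\mathbf n)=2\sum_t(\gamma(t)-\overline\gamma)\rho(\mathbf n(t))$ and let $\Pi_-(A)$, $\Pi_0(A)$ be the orthogonal projectors on the negative part and on the kernel of a Hermitian operator $A$. For a numbering $\mathbf n^*$ and a permutation $\sigma$ witnessing that $\gamma$ is balanced, let $\pi^\gamma_{\rho,\mathbf n^*}(\mathbf n)=\Pi_-(E(\mathbf n))+\frac12\Pi_0(E(\mathbf n))$ if $\mathbf n\in\{\mathbf n^*,\mathbf n^*\circ\sigma\}$, and $0$ otherwise. Let $\mathbf n_{\rm bv}$ be the numbering with $\mathbf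 n_{\rm bv}^{-1}(m)=2m-1$ for $m\le\lceil n/2\rceil$ and $\mathbf n_{\rm bv}^{-1}(m)=2(n+1-m)$ otherwise. *The ensembles.* For $h\ge0$, let $\rho_h$ denote any ensemble with uniform prior, $\operatorname{Tr}\rho_h(m)=1/n$ for all $m$, such that for some Hilbert–Schmidt orthonormal basis $(\sigma_k)_{k=1}^3$ of the traceless Hermitian operators on $\mathcal H$ and some $\lambda\ge0$ $$\big(\operatorname{Tr}[\rho_h(m)\sigma_k]\big)_{k=1}^3=\lambda\Big(\cos\tfrac{2\pi(m-1)}n,\ \sin\tfrac{2\pi(m-1)}n,\ (-1)^{m-1}h\Big),\qquad m=1,\dots,n.$$ **Statement.** (i) Let $\gamma$ be nondecreasing and balanced, let $\sigma\neq\mathrm{id}$ be any permutation witnessing this (so $n\ge2$), and let $0\le h\le b_n$, where $$b_n=\begin{cases}0,& n\text{ odd},\\ \sqrt{\frac{1-\cos(2\pi/n)}2},& n/2\text{ even},\\ \sqrt{\frac{\cos(2\pi/n)-\cos(4\pi/n)}2},& n/2\text{ odd, } n\ne 2,\end{cases}\qquad b_2=0.$$ Then $\pi^\gamma_{\rho_h,\mathbf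 n_{\rm bv}}$ is a numbering-valued measurement and attains the minimum guesswork: $G^\gamma_{\min}(\rho_h)=G^\gamma(\rho_h,\pi^\gamma_{\rho_h,\mathbf n_{\rm bv}})$, the minimum in $G^\gamma_{\min}$ being attained; moreover $G^\gamma(\rho_h,\pi^\gamma_{\rho_h,\mathbf n_{\rm bv}})\le G^\gamma(\rho_h,\pi)$ for every numbering-valued measurement $\pi$. (ii) This covers the following uniform ensembles $\rho(i)=\frac1N|\psi_i\rangle\langle\psi_i|$, with unit vectors $\psi_1,\dots,\psi_N\in\mathcal H$, which, after a suitable relabelling in the MUB cases, are of the form $\rho_h$ for the stated $n=N$ and $h$: the real SIC ensemble (three vectors that are real in some orthonormal basis, with pairwise overlaps $|\langle\psi_i,\psi_j\rangle|^2=1/4$), with $n=3$, $h=0$; the real MUB ensemble (two mutually unbiased bases that are real in a common orthonormal basis), with $n=4$, $h=0$; the complex SIC ensemble (four vectors with pairwise overlaps $1/3$), with $n=4$, $h=1/\sqrt2=b_4$; the complex MUB ensemble (three mutually unbiased bases), with $n=6$, $h=1/\sqrt2=b_6$. -/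

import Mathlib

open scoped CStarAlgebra

noncomputable section

namespace Guesswork

/-! Labels, time steps: the set `{1, …, n}` is modelled by `Fin n` (element `i` stands for `i + 1`).
A numbering, i.e. a bijection `t ↦ 𝐧(t)` from time steps to labels, is a permutation of `Fin n`. -/

/-- Operators on a finite-dimensional Hilbert space. -/
abbrev Op (H : Type*) [NormedAddCommGroup H] [InnerProductSpace ℂ H] := H →L[ℂ] H

/-- The trace of an operator. -/
def tr {H : Type*} [NormedAddCommGroup H] [InnerProductSpace ℂ H] (A : Op H) : ℂ :=
  LinearMap.trace ℂ H (A : H →ₗ[ℂ] H)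

/-- The concrete `d`-dimensional Hilbert space. -/
abbrev Q (d : ℕ) := EuclideanSpace ℂ (Fin d)

/-! ### Ensembles -/

/-- `ρ` is an ensemble on `H`: positive operators whose traces add up to one. -/
structure IsEnsemble {H : Type*} [NormedAddCommGroup H] [InnerProductSpace ℂ H]
    {n : ℕ} (ρ : Fin n → Op H) : Prop where
  nonneg : ∀ m, (ρ m).IsPositive
  sum_trace : ∑ m, tr (ρ m) = 1

/-- The average of a cost function. -/
def avg {n : ℕ} (γ : Fin n → ℝ) : ℝ := (∑ t, γ t) / n

/-- The cost function `γ` is balanced, as witnessed by the permutation `σ`. -/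
def IsBalancedBy {n : ℕ} (γ : Fin n → ℝ) (σ : Equiv.Perm (Fin n)) : Prop :=
  ∀ t, (γ t + γ (σ⁻¹ t)) / 2 = avg γ

/-! ### Sequential-instrument strategies -/

/-- An instrument with outcomes in `Fin n`: completely positive maps whose sum preserves the
trace. -/
structure Instrument (n : ℕ) (H K : Type*)
    [NormedAddCommGroup H] [InnerProductSpace ℂ H] [CompleteSpace H]
    [NormedAddCommGroup K] [InnerProductSpace ℂ K] [CompleteSpace K] where
  op : Fin n → (Op H →CP Op K)
  trace_preserving : ∀ X : Op H, ∑ m, tr (op m X) = tr X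

/-- A sequence of instruments `ι₁, ι₂, …`, where `ι₁` acts on `H` and the output space of the
`t`-th one, which is the input space of the next, has an arbitrary finite dimension. Here `first`
is `ι₁` and `next t` is the instrument of the time step following `t : ℕ`, counted from zero.
Only the first `n` of them enter the guesswork. -/
structure Strategy (n : ℕ) (H : Type*)
    [NormedAddCommGroup H] [InnerProductSpace ℂ H] [CompleteSpace H] where
  dim : ℕ → ℕ
  first : Instrument n H (Q (dim 0))
  next : ∀ t : ℕ, Instrument n (Q (dim t)) (Q (dim (t + 1)))

section Sequential

variable {n : ℕ} {H : Type*} [NormedAddCommGroup H] [InnerProductSpace ℂ H] [CompleteSpace H]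

/-- The unnormalized state after the steps `0, …, t` have given the outcomes `m 0, …, m t`. -/
def Strategy.run (S : Strategy n H) :
    (t : ℕ) → (Fin (t + 1) → Fin n) → Op H → Op (Q (S.dim t))
  | 0, m, X => S.first.op (m 0) X
  | t + 1, m, X =>
      (S.next t).op (m (Fin.last (t + 1))) (S.run t (fun s => m s.castSucc) X)

open Classical in
/-- The probability that the first queries, up to the one at time `t`, are `m 0, …, m t`, and that
the query at time `t` is the first correct one. -/
def Strategy.jointProb (S : Strategy n H) (ρ : Fin n → Op H) (t : ℕ)
    (m : Fin (t + 1) → Fin n) : ℝ :=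
  if ∃ s : Fin t, m s.castSucc = m (Fin.last t) then 0
  else (tr (S.run t m (ρ (m (Fin.last t))))).re

/-- The probability that the query at time `t` is the correct one. -/
def Strategy.prob (S : Strategy n H) (ρ : Fin n → Op H) (t : Fin n) : ℝ :=
  ∑ m : Fin (t.val + 1) → Fin n, S.jointProb ρ t m

/-- The expected cost of a sequential-instrument strategy. -/
def Strategy.guesswork (S : Strategy n H) (γ : Fin n → ℝ) (ρ : Fin n → Op H) : ℝ :=
  ∑ t, γ t * S.prob ρ t

/-- The strategy plays the game to its end on the ensemble `ρ`: the probabilities that the correct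
query is the first, the second, …, the `n`-th one add up to one. -/
def Strategy.Concludes (S : Strategy n H) (ρ : Fin n → Op H) : Prop :=
  ∑ t, S.prob ρ t = 1

/-- `g` is the minimum guesswork: the minimum of the expected cost over all sequential-instrument
strategies that certainly reach the correct query. -/
def IsMinGuesswork (γ : Fin n → ℝ) (ρ : Fin n → Op H) (g : ℝ) : Prop :=
  IsLeast {x : ℝ | ∃ S : Strategy n H, S.Concludes ρ ∧ x = S.guesswork γ ρ} g

end Sequential

/-! ### Single-measurement strategies -/

section Single

variable {n : ℕ} {H : Type*} [NormedAddCommGroup H] [InnerProductSpace ℂ H]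

/-- `π` is a numbering-valued measurement. -/
structure IsNumberingMeasurement (π : Equiv.Perm (Fin n) → Op H) : Prop where
  nonneg : ∀ ν, (π ν).IsPositive
  sum_eq_one : ∑ ν, π ν = 1

/-- The expected cost of the numbering-valued measurement `π`. -/
def guesswork (γ : Fin n → ℝ) (ρ : Fin n → Op H) (π : Equiv.Perm (Fin n) → Op H) : ℝ :=
  ∑ t, γ t * ∑ ν, (tr (π ν * ρ (ν t))).re

/-- The operator `E(𝐧) = 2 ∑ₜ (γ(t) - avg γ) ρ(𝐧(t))`. -/
def effOp (γ : Fin n → ℝ) (ρ : Fin n → Op H) (ν : Equiv.Perm (Fin n)) : Op H :=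
  (2 : ℂ) • ∑ t, ((γ t - avg γ : ℝ) : ℂ) • ρ (ν t)

/-- The orthogonal projector on the negative part of `A`, i.e. on the span of all eigenspaces of
`A` for negative eigenvalues. -/
def projNeg [FiniteDimensional ℂ H] (A : Op H) : Op H :=
  (⨆ μ : {x : ℝ // x < 0},
    Module.End.eigenspace (A : H →ₗ[ℂ] H) ((μ : ℝ) : ℂ)).starProjection

/-- The orthogonal projector on the null part (the kernel) of `A`. -/
def projNull [FiniteDimensional ℂ H] (A : Op H) : Op H :=
  (LinearMap.ker (A : H →ₗ[ℂ] H)).starProjection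

open Classical in
/-- The measurement `π^γ_{ρ, 𝐧*}` for the balanced cost function `γ` with permutation `σ`:
it is `Π₋ + Π₀ / 2` of `E(𝐧)` if `𝐧` is `𝐧*` or `𝐧* ∘ σ`, and zero otherwise. -/
def optMeasurement [FiniteDimensional ℂ H] (γ : Fin n → ℝ) (σ : Equiv.Perm (Fin n))
    (ρ : Fin n → Op H) (νstar : Equiv.Perm (Fin n)) (ν : Equiv.Perm (Fin n)) : Op H :=
  if ν = νstar ∨ ν = νstar * σ then
    projNeg (effOp γ ρ ν) + (1 / 2 : ℂ) • projNull (effOp γ ρ ν)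
  else 0

end Single

/-! ### The benevolent numbering -/

/-- The inverse of the benevolent numbering. With labels and times counted from one it is
`m ↦ 2 m - 1` for `m ≤ ⌈n / 2⌉` and `m ↦ 2 (n + 1 - m)` otherwise. -/
def bvInv (n : ℕ) (m : Fin n) : Fin n :=
  if h : m.val + 1 ≤ (n + 1) / 2 then ⟨2 * (m.val + 1) - 1 - 1, by omega⟩
  else ⟨2 * (n + 1 - (m.val + 1)) - 1, by omega⟩

theorem bvInv_bijective (n : ℕ) : Function.Bijective (bvInv n) := by
  rw [← Finite.injective_iff_bijective]
  intro a b hab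
  unfold bvInv at hab
  have ha := a.isLt
  have hb := b.isLt
  apply Fin.ext
  split_ifs at hab <;> simp only [Fin.mk.injEq] at hab <;> omega

/-- The benevolent numbering `𝐧_bv`. -/
def bvNumbering (n : ℕ) : Equiv.Perm (Fin n) :=
  (Equiv.ofBijective (bvInv n) (bvInv_bijective n)).symm

/-! ### Regular polygons and antiprisms in the Bloch sphere -/

section Qubit

variable {H : Type*} [NormedAddCommGroup H] [InnerProductSpace ℂ H]

/-- `s` is an orthonormal family of three traceless Hermitian operators for the Hilbert-Schmidt
product. On a two-dimensional space it is an orthonormal basis of the traceless subspace. -/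
structure IsPauliBasis [CompleteSpace H] (s : Fin 3 → Op H) : Prop where
  selfAdjoint : ∀ k, IsSelfAdjoint (s k)
  traceless : ∀ k, tr (s k) = 0
  orthonormal : ∀ k l, tr (s k * s l) = if k = l then 1 else 0

/-- The Pauli vector of a Hermitian operator. -/
def pauliVec (s : Fin 3 → Op H) (A : Op H) : Fin 3 → ℝ := fun k => (tr (A * s k)).re

/-- `ρ` is an ensemble with uniform prior whose Pauli vectors, for some orthonormal basis, are the
vertices of a regular polygon (`h = 0`) or of an antiprism (`h > 0`, `n` even). The label `m` stands
for `m + 1`. -/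
structure IsAntiprismEnsemble [CompleteSpace H] {n : ℕ} (h : ℝ) (ρ : Fin n → Op H) : Prop where
  ensemble : IsEnsemble ρ
  uniform : ∀ m, tr (ρ m) = 1 / (n : ℂ)
  vertices : ∃ s : Fin 3 → Op H, IsPauliBasis s ∧ ∃ r : ℝ, 0 ≤ r ∧ ∀ m : Fin n,
    pauliVec s (ρ m) =
      r • ![Real.cos (2 * Real.pi * m.val / n), Real.sin (2 * Real.pi * m.val / n),
        (-1) ^ m.val * h]

/-- The upper bound on the height parameter `h`. For `n = 2` the radicand is negative, and the root
is zero. -/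
def heightBound (n : ℕ) : ℝ :=
  if Odd n then 0
  else if Even (n / 2) then √((1 - Real.cos (2 * Real.pi / n)) / 2)
  else √((Real.cos (2 * Real.pi / n) - Real.cos (4 * Real.pi / n)) / 2)

/-! ### SIC and MUB ensembles of a qubit -/

/-- `ρ` is the uniform ensemble of the pure states given by the unit vectors `ψ`. -/
def IsUniformPure {ι : Type*} [Fintype ι] (ψ : ι → H) (ρ : ι → Op H) : Prop :=
  (∀ i, ‖ψ i‖ = 1) ∧
    ∀ i, ρ i = (1 / (Fintype.card ι : ℂ)) • InnerProductSpace.rankOne ℂ (ψ i) (ψ i)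

/-- The vectors `ψ` have real coordinates in a common orthonormal basis. -/
def IsRealFamily {ι : Type*} (ψ : ι → H) : Prop :=
  ∃ b : OrthonormalBasis (Fin 2) ℂ H, ∀ i k, (inner ℂ (b k) (ψ i)).im = 0

/-- Complex qubit SIC ensemble: `d ^ 2 = 4` states with pairwise overlaps `1 / (d + 1) = 1 / 3`. -/
def IsComplexSIC (ρ : Fin 4 → Op H) : Prop :=
  ∃ ψ : Fin 4 → H, IsUniformPure ψ ρ ∧ ∀ i j, i ≠ j → ‖inner ℂ (ψ i) (ψ j)‖ ^ 2 = 1 / 3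

/-- Real qubit SIC ensemble: `d (d + 1) / 2 = 3` real states with pairwise overlaps
`1 / (d + 2) = 1 / 4`. -/
def IsRealSIC (ρ : Fin 3 → Op H) : Prop :=
  ∃ ψ : Fin 3 → H, IsRealFamily ψ ∧ IsUniformPure ψ ρ ∧
    ∀ i j, i ≠ j → ‖inner ℂ (ψ i) (ψ j)‖ ^ 2 = 1 / 4

/-- `ψ (a, 0), ψ (a, 1)` are orthonormal for each `a`, and distinct pairs are mutually unbiased. -/
def IsMutuallyUnbiased {k : ℕ} (ψ : Fin k × Fin 2 → H) : Prop :=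
  (∀ a, Orthonormal ℂ fun i => ψ (a, i)) ∧
    ∀ a b, a ≠ b → ∀ i j, ‖inner ℂ (ψ (a, i)) (ψ (b, j))‖ ^ 2 = 1 / 2

/-- Complex qubit MUB ensemble: the six states of `d + 1 = 3` mutually unbiased bases. -/
def IsComplexMUB (ρ : Fin 3 × Fin 2 → Op H) : Prop :=
  ∃ ψ : Fin 3 × Fin 2 → H, IsUniformPure ψ ρ ∧ IsMutuallyUnbiased ψ

/-- Real qubit MUB ensemble: the four states of `d / 2 + 1 = 2` real mutually unbiased bases. -/
def IsRealMUB (ρ : Fin 2 × Fin 2 → Op H) : Prop :=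
  ∃ ψ : Fin 2 × Fin 2 → H, IsRealFamily ψ ∧ IsUniformPure ψ ρ ∧ IsMutuallyUnbiased ψ

end Qubit

end Guesswork

end

/-! Write `E(ν)` for `effOp γ ρ ν`. Consider positive functionals `φ i` that add up to the trace,
each followed by queries in the order `ν i`. Their cost is `avg γ + (∑ φ i (E(ν i))) / 2`
(`cost_eq_avg_add`). A uniform prior makes `E` traceless, so on a qubit its eigenvalues are `±
radius`, whence `φ (E) ≥ -radius * φ 1`. As the numbers `φ i 1` add up to `Tr 1 = 2`, every cost is
at least `avg γ` minus the largest radius (`avg_sub_le_cost`). Sequential strategies obey the same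
bound: the complete outcome sequences give such functionals, and sure conclusion lets each sequence
be replaced by a numbering at no change of cost (`Strategy.exists_functionals`).

Conversely, balancedness gives `E(ν * σ) = -E(ν)`. The negative parts of `E(ν)` and `-E(ν)` are
complementary, so the two-outcome measurement costs exactly `avg γ - radius (E(ν))`
(`guesswork_optMeasurement`), and a register that stores the outcome turns it into a sequential
strategy.

It remains to see that the benevolent numbering maximizes the radius. By Parseval the squared radius
is proportional to `∑ x, ∑ y, g (T x) * g (T y) * F (gap x y)`, with `T` the inverse numbering, `g =
γ - avg γ` and `F` the scalar product of two vertices. The bound on `h` makes `F` decrease with the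
cyclic distance from distance one on. The maximum is then found by polarization: for a reflection of
the cycle, exchange the times of those mirror pairs which `T` orders unlike the zigzag. This never
lowers the functional (`assignValue_le_polarize`) and strictly raises the correlation with the
zigzag (`zigzagCorr_lt_polarize`). A lexicographic maximizer of both quantities therefore agrees
with the zigzag on every pair.

For the SIC and MUB ensembles, the overlaps determine the Gram matrix of the Bloch vectors, and a
Gram matrix determines the vectors up to the choice of the orthonormal basis
(`exists_isPauliBasis_of_gram`). -/

noncomputable section

namespace Guesswork

/-! ### A rearrangement inequality on the cycle -/

/-- The distance of two labels on the line. -/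
def gap {n : ℕ} (x y : Fin n) : ℕ := (x.val - y.val) + (y.val - x.val)

theorem gap_comm {n : ℕ} (x y : Fin n) : gap x y = gap y x := by
  unfold gap; omega

/-- The reflection `x ↦ c - x` of the cycle. -/
def reflect {n : ℕ} (c x : Fin n) : Fin n :=
  if h : x.val ≤ c.val then ⟨c.val - x.val, by omega⟩ else ⟨c.val + n - x.val, by omega⟩

theorem reflect_val {n : ℕ} (c x : Fin n) :
    (x.val ≤ c.val ∧ (reflect c x).val = c.val - x.val) ∨
      (c.val < x.val ∧ (reflect c x).val = c.val + n - x.val) := by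
  unfold reflect
  split_ifs with h
  · exact Or.inl ⟨h, rfl⟩
  · exact Or.inr ⟨by omega, rfl⟩

theorem reflect_reflect {n : ℕ} (c x : Fin n) : reflect c (reflect c x) = x := by
  apply Fin.ext
  have := reflect_val c x
  have := reflect_val c (reflect c x)
  omega

/-- Take `c = x + y` modulo `n`. Since every pair of labels is exchanged by some reflection,
comparisons of mirror images determine the whole order. -/
theorem exists_reflect_eq {n : ℕ} (x y : Fin n) : ∃ c, reflect c x = y := by
  by_cases h : x.val + y.val < n
  · refine ⟨⟨x.val + y.val, h⟩, Fin.ext ?_⟩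
    have := reflect_val ⟨x.val + y.val, h⟩ x
    dsimp only at this
    omega
  · refine ⟨⟨x.val + y.val - n, by omega⟩, Fin.ext ?_⟩
    have := reflect_val ⟨x.val + y.val - n, by omega⟩ x
    dsimp only at this
    omega

theorem bvInv_val (n : ℕ) (x : Fin n) :
    (2 * x.val + 1 ≤ n ∧ (bvInv n x).val = 2 * x.val) ∨
      (n < 2 * x.val + 1 ∧ (bvInv n x).val = 2 * (n - x.val) - 1) := by
  unfold bvInv
  split_ifs with h
  · left; dsimp only; omega
  · right; dsimp only; omega

/-- The zigzag sorts the labels by their distance from the point `-1/4` of the circle: `bvInv` is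
twice that distance minus `1/2`. The axis of the reflection passes through `c / 2` and `(c + n) /
2`, so the labels that precede their mirror images fill the open half circle around `-1/4`; the two
alternatives are its pieces on the line. -/
theorem two_mul_lt_of_bvInv_lt {n : ℕ} {c x : Fin n} (hx : bvInv n x < bvInv n (reflect c x)) :
    (2 * x.val < c.val ∧ (reflect c x).val = c.val - x.val) ∨
      (c.val + n < 2 * x.val ∧ (reflect c x).val = c.val + n - x.val) := by
  have h1 := reflect_val c x
  have h3 := bvInv_val n x
  have h5 := bvInv_val n (reflect c x)
  rw [Fin.lt_def] at hx
  rcases h3 with ⟨h3, h3'⟩ | ⟨h3, h3'⟩ <;> rcases h5 with ⟨h5, h5'⟩ | ⟨h5, h5'⟩ <;>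
    rw [h3', h5'] at hx <;> omega

/-- Two points on the side of a reflection that the zigzag prefers are closer to each other than
to each other's mirror image. -/
theorem min_gap_le_of_bvInv_lt {n : ℕ} {c x y : Fin n} (hx : bvInv n x < bvInv n (reflect c x))
    (hy : bvInv n y < bvInv n (reflect c y)) :
    min (gap x y) (n - gap x y) ≤ min (gap (reflect c x) y) (n - gap (reflect c x) y) := by
  have hxn := x.isLt
  have hyn := y.isLt
  have hcn := c.isLt
  unfold gap
  rcases two_mul_lt_of_bvInv_lt hx with ⟨h1, h1'⟩ | ⟨h1, h1'⟩ <;>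
    rcases two_mul_lt_of_bvInv_lt hy with ⟨h2, -⟩ | ⟨h2, -⟩ <;> rw [h1'] <;>
    clear h1' hx hy
  all_goals
    rcases le_total x.val y.val with h | h
    · have e : x.val - y.val = 0 := by omega
      rw [e]
      refine le_min ?_ ?_ <;> omega
    · have e : y.val - x.val = 0 := by omega
      rw [e]
      refine le_min ?_ ?_ <;> omega

/-- A reflection is an isometry of the cycle, but `gap` is measured on the line; it turns into `n -
gap` when exactly one of the two labels wraps around. -/
theorem gap_reflect {n : ℕ} (c x y : Fin n) :
    gap (reflect c x) (reflect c y) = gap x y ∨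
      gap (reflect c x) (reflect c y) = n - gap x y ∧ 0 < gap x y ∧ gap x y < n := by
  have h1 := reflect_val c x
  have h2 := reflect_val c y
  unfold gap
  omega

/-- A function of the distance on a cycle of `n` points that decreases with the distance, except
perhaps at distance zero. -/
structure IsCyclicDecreasing (n : ℕ) (F : ℕ → ℝ) : Prop where
  symm : ∀ d, 0 < d → d < n → F (n - d) = F d
  anti : ∀ d, 1 ≤ d → 2 * (d + 1) ≤ n → F (d + 1) ≤ F d

namespace IsCyclicDecreasing

variable {n : ℕ} {F : ℕ → ℝ}

theorem le_of_le (hF : IsCyclicDecreasing n F) {d e : ℕ} (hd : 1 ≤ d) (hde : d ≤ e)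
    (he : 2 * e ≤ n) : F e ≤ F d := by
  induction e, hde using Nat.le_induction with
  | base => exact le_rfl
  | succ e hde ih => exact (hF.anti e (by omega) he).trans (ih (by omega))

theorem apply_min (hF : IsCyclicDecreasing n F) {d : ℕ} (hd : 0 < d) (hdn : d < n) :
    F (min d (n - d)) = F d := by
  rcases min_choice d (n - d) with h | h <;> rw [h]
  exact hF.symm d hd hdn

theorem le_of_min_le (hF : IsCyclicDecreasing n F) {d e : ℕ} (hd : 0 < d) (hdn : d < n)
    (he : 0 < e) (hen : e < n) (h : min d (n - d) ≤ min e (n - e)) : F e ≤ F d := by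
  rw [← hF.apply_min hd hdn, ← hF.apply_min he hen]
  exact hF.le_of_le (by omega) h (by omega)

theorem apply_gap_reflect (hF : IsCyclicDecreasing n F) (c x y : Fin n) :
    F (gap (reflect c x) (reflect c y)) = F (gap x y) := by
  rcases gap_reflect c x y with h | ⟨h, h0, hn⟩ <;> rw [h]
  exact hF.symm _ h0 hn

theorem apply_gap_reflect_left (hF : IsCyclicDecreasing n F) (c x y : Fin n) :
    F (gap (reflect c x) y) = F (gap x (reflect c y)) := by
  rw [← hF.apply_gap_reflect c x (reflect c y), reflect_reflect]

/-- The two inequations keep both distances positive, because nothing is assumed about `F 0`. -/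
theorem apply_gap_reflect_le (hF : IsCyclicDecreasing n F) {c x y : Fin n}
    (hx : bvInv n x < bvInv n (reflect c x)) (hy : bvInv n y < bvInv n (reflect c y))
    (hxy : x ≠ y) (hxy' : reflect c x ≠ y) : F (gap (reflect c x) y) ≤ F (gap x y) := by
  rw [Ne, Fin.ext_iff] at hxy hxy'
  have := (reflect c x).isLt
  refine hF.le_of_min_le ?_ ?_ ?_ ?_ (min_gap_le_of_bvInv_lt hx hy) <;> unfold gap <;> omega

end IsCyclicDecreasing

/-! ### Polarization in the reflections of the cycle -/

section Polarization

variable {n : ℕ}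

/-- The objective function: the quadratic assignment functional of the times `T`. -/
def assignValue (g : Fin n → ℝ) (F : ℕ → ℝ) (T : Equiv.Perm (Fin n)) : ℝ :=
  ∑ x, ∑ y, g (T x) * g (T y) * F (gap x y)

/-- The times `T` order `x` and its mirror image differently from the zigzag. -/
def Misordered (c : Fin n) (T : Equiv.Perm (Fin n)) (x : Fin n) : Prop :=
  ¬ (T x < T (reflect c x) ↔ bvInv n x < bvInv n (reflect c x))

open Classical in
/-- The involution that exchanges `x` with its mirror image where `T` is misordered. -/
def polarizeFun (c : Fin n) (T : Equiv.Perm (Fin n)) (x : Fin n) : Fin n :=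
  if Misordered c T x then reflect c x else x

theorem bvInv_injective : Function.Injective (bvInv n) := (bvInv_bijective n).injective

theorem Misordered.ne {c x : Fin n} {T : Equiv.Perm (Fin n)} (h : Misordered c T x) :
    reflect c x ≠ x := by
  intro hx
  simp [Misordered, hx] at h

theorem misordered_reflect (c x : Fin n) (T : Equiv.Perm (Fin n)) :
    Misordered c T (reflect c x) ↔ Misordered c T x := by
  by_cases hx : reflect c x = x
  · rw [hx]
  have h1 : T (reflect c x) ≠ T x := fun h => hx (T.injective h)
  have h2 : bvInv n (reflect c x) ≠ bvInv n x := fun h => hx (bvInv_injective h)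
  unfold Misordered
  rw [reflect_reflect]
  rcases lt_or_gt_of_ne h1 with h1 | h1 <;> rcases lt_or_gt_of_ne h2 with h2 | h2 <;>
    simp [h1, h2, h1.not_gt, h2.not_gt]

theorem polarizeFun_reflect (c x : Fin n) (T : Equiv.Perm (Fin n)) :
    polarizeFun c T (reflect c x) = reflect c (polarizeFun c T x) := by
  unfold polarizeFun
  rw [misordered_reflect]
  split_ifs <;> rfl

theorem polarizeFun_involutive (c : Fin n) (T : Equiv.Perm (Fin n)) :
    Function.Involutive (polarizeFun c T) := by
  intro x
  by_cases h : Misordered c T x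
  · have : polarizeFun c T x = reflect c x := if_pos h
    rw [this, polarizeFun_reflect, this, reflect_reflect]
  · have : polarizeFun c T x = x := if_neg h
    rw [this, this]

/-- The polarization of the times `T` in the reflection `c`. -/
def polarize (c : Fin n) (T : Equiv.Perm (Fin n)) : Equiv.Perm (Fin n) :=
  (polarizeFun_involutive c T).toPerm.trans T

theorem polarize_apply (c : Fin n) (T : Equiv.Perm (Fin n)) (x : Fin n) :
    polarize c T x = T (polarizeFun c T x) := rfl

theorem sum_reflect (c : Fin n) (a : Fin n → ℝ) : ∑ x, a (reflect c x) = ∑ x, a x :=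
  Equiv.sum_comp (Function.Involutive.toPerm _ (reflect_reflect c)) a

theorem sum_polarizeFun (c : Fin n) (T : Equiv.Perm (Fin n)) (a : Fin n → ℝ) :
    ∑ x, a (polarizeFun c T x) = ∑ x, a x :=
  Equiv.sum_comp (Function.Involutive.toPerm _ (polarizeFun_involutive c T)) a

/-- If `x` and `y` both lie on the side that the zigzag visits first, the first factor is
nonnegative, the second nonpositive, and the third nonpositive because `y` is nearer to `x` than to
its mirror image. Passing from `x` or `y` to its mirror image flips two signs, which yields the
other three cases. -/
theorem polarize_sign {g : Fin n → ℝ} (hg : Monotone g) {F : ℕ → ℝ}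
    (hF : IsCyclicDecreasing n F) {c x y : Fin n} {T : Equiv.Perm (Fin n)}
    (hx : Misordered c T x) (hy : ¬ Misordered c T y) :
    0 ≤ (g (T x) - g (T (reflect c x))) * (g (T y) - g (T (reflect c y))) *
      (F (gap (reflect c x) y) - F (gap x y)) := by
  by_cases hyy : reflect c y = y
  · simp [hyy]
  have hxx := hx.ne
  have hxy : x ≠ y := fun h => hy (h ▸ hx)
  have hxy' : reflect c x ≠ y := fun h => hy (h ▸ (misordered_reflect c x T).2 hx)
  have hxy'' : reflect c (reflect c x) ≠ reflect c y := by
    intro h; apply hxy'; rw [← reflect_reflect c y, ← h, reflect_reflect]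
  have hxy3 : x ≠ reflect c y := by rwa [reflect_reflect] at hxy''
  have hxy4 : reflect c x ≠ reflect c y := by
    intro h; apply hxy; rw [← reflect_reflect c y, ← h, reflect_reflect]
  have e1 := hF.apply_gap_reflect_left c x y
  have e2 := hF.apply_gap_reflect c x y
  have b1 : bvInv n (reflect c x) ≠ bvInv n x := fun h => hxx (bvInv_injective h)
  have b2 : bvInv n (reflect c y) ≠ bvInv n y := fun h => hyy (bvInv_injective h)
  unfold Misordered at hx hy
  rcases lt_or_gt_of_ne b1 with h1 | h1 <;> rcases lt_or_gt_of_ne b2 with h2 | h2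
  · have hk := hF.apply_gap_reflect_le (c := c) (x := reflect c x) (y := reflect c y)
      (by rwa [reflect_reflect]) (by rwa [reflect_reflect]) hxy4 hxy''
    rw [reflect_reflect, e2, ← e1] at hk
    have t1 : g (T x) ≤ g (T (reflect c x)) := hg (by
      have := h1.not_gt
      simp only [this, iff_false, not_not] at hx; exact hx.le)
    have t2 : g (T (reflect c y)) ≤ g (T y) := hg (by
      have := h2.not_gt
      simp only [this, iff_false, not_not, not_lt] at hy; exact hy)
    exact mul_nonneg_of_nonpos_of_nonpos
      (mul_nonpos_of_nonpos_of_nonneg (by linarith) (by linarith)) (by linarith)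
  · have hk := hF.apply_gap_reflect_le (c := c) (x := reflect c x) (y := y)
      (by rwa [reflect_reflect]) h2 hxy' (by rwa [reflect_reflect])
    rw [reflect_reflect] at hk
    have t1 : g (T x) ≤ g (T (reflect c x)) := hg (by
      have := h1.not_gt
      simp only [this, iff_false, not_not] at hx; exact hx.le)
    have t2 : g (T y) ≤ g (T (reflect c y)) := hg (by
      simp only [h2, iff_true, not_not] at hy; exact hy.le)
    exact mul_nonneg (mul_nonneg_of_nonpos_of_nonpos (by linarith) (by linarith)) (by linarith)
  · have hk := hF.apply_gap_reflect_le (c := c) (x := x) (y := reflect c y)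
      h1 (by rwa [reflect_reflect]) hxy3 hxy4
    rw [e2, ← e1] at hk
    have t1 : g (T (reflect c x)) ≤ g (T x) := hg (by
      simp only [h1, iff_true, not_lt] at hx; exact hx)
    have t2 : g (T (reflect c y)) ≤ g (T y) := hg (by
      have := h2.not_gt
      simp only [this, iff_false, not_not, not_lt] at hy; exact hy)
    exact mul_nonneg (mul_nonneg (by linarith) (by linarith)) (by linarith)
  · have hk := hF.apply_gap_reflect_le (c := c) (x := x) (y := y) h1 h2 hxy hxy'
    have t1 : g (T (reflect c x)) ≤ g (T x) := hg (by
      simp only [h1, iff_true, not_lt] at hx; exact hx)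
    have t2 : g (T y) ≤ g (T (reflect c y)) := hg (by
      simp only [h2, iff_true, not_not] at hy; exact hy.le)
    exact mul_nonneg_of_nonpos_of_nonpos
      (mul_nonpos_of_nonneg_of_nonpos (by linarith) (by linarith)) (by linarith)

/-- Collect the change of the functional over the four pairs formed by `x`, `y` and their mirror
images. If both or neither of the mirror pairs are exchanged, distances are preserved and nothing
changes. If exactly one is, the four terms factor into the product of `polarize_sign`. -/
theorem assignValue_le_polarize {g : Fin n → ℝ} (hg : Monotone g) {F : ℕ → ℝ}
    (hF : IsCyclicDecreasing n F) (c : Fin n) (T : Equiv.Perm (Fin n)) :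
    assignValue g F T ≤ assignValue g F (polarize c T) := by
  set κ := polarizeFun c T with hκ
  have h1 : assignValue g F (polarize c T) =
      ∑ x, ∑ y, g (T x) * g (T y) * F (gap (κ x) (κ y)) := by
    unfold assignValue
    simp only [polarize_apply]
    rw [← sum_polarizeFun c T]
    refine Finset.sum_congr rfl fun x _ => ?_
    rw [← sum_polarizeFun c T]
    simp only [polarizeFun_involutive c T _, hκ]
  set D : Fin n → Fin n → ℝ := fun x y =>
    g (T x) * g (T y) * (F (gap (κ x) (κ y)) - F (gap x y)) with hD
  have h2 : assignValue g F (polarize c T) - assignValue g F T = ∑ x, ∑ y, D x y := by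
    rw [h1]
    unfold assignValue
    simp only [hD, mul_sub, Finset.sum_sub_distrib]
  have h3 : ∑ x, ∑ y, D x y = (∑ x, ∑ y, (D x y + D (reflect c x) y + D x (reflect c y) +
      D (reflect c x) (reflect c y))) / 4 := by
    simp only [Finset.sum_add_distrib]
    have e1 : ∀ x, ∑ y, D x (reflect c y) = ∑ y, D x y := fun x => sum_reflect c (D x)
    have e2 : ∑ x, ∑ y, D (reflect c x) y = ∑ x, ∑ y, D x y :=
      sum_reflect c fun x => ∑ y, D x y
    simp only [e1, e2]
    ring
  have h4 : 0 ≤ ∑ x, ∑ y, (D x y + D (reflect c x) y + D x (reflect c y) +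
      D (reflect c x) (reflect c y)) := by
    refine Finset.sum_nonneg fun x _ => Finset.sum_nonneg fun y _ => ?_
    have k : ∀ z, κ (reflect c z) = reflect c (κ z) := fun z => polarizeFun_reflect c z T
    have kp : ∀ {z}, Misordered c T z → κ z = reflect c z := fun h => if_pos h
    have kn : ∀ {z}, ¬ Misordered c T z → κ z = z := fun h => if_neg h
    have e1 := hF.apply_gap_reflect_left c x y
    have e2 := hF.apply_gap_reflect c x y
    by_cases hx : Misordered c T x <;> by_cases hy : Misordered c T y
    · simp only [hD, k, kp hx, kp hy, reflect_reflect, e1, e2]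
      apply le_of_eq; ring
    · have := polarize_sign hg hF hx hy
      simp only [hD, k, kp hx, kn hy, reflect_reflect, e1, e2] at this ⊢
      linarith
    · have := polarize_sign hg hF hy hx
      rw [gap_comm (reflect c y), gap_comm y] at this
      simp only [hD, k, kn hx, kp hy, reflect_reflect, e1, e2] at this ⊢
      linarith
    · simp only [hD, k, kn hx, kn hy, e1, e2]
      apply le_of_eq; ring
  linarith

/-- The correlation of the times `T` with the zigzag. -/
def zigzagCorr (T : Equiv.Perm (Fin n)) : ℝ := ∑ x, (bvInv n x : ℝ) * (T x : ℝ)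

/-- Each exchanged mirror pair contributes a product of two differences of equal strict sign, as in
the rearrangement inequality; the other pairs contribute zero. -/
theorem zigzagCorr_lt_polarize {c x : Fin n} {T : Equiv.Perm (Fin n)} (hx : Misordered c T x) :
    zigzagCorr T < zigzagCorr (polarize c T) := by
  set D : Fin n → ℝ := fun x => (bvInv n x : ℝ) * ((polarize c T x : ℝ) - (T x : ℝ)) with hD
  have h2 : zigzagCorr (polarize c T) - zigzagCorr T = ∑ x, D x := by
    simp only [zigzagCorr, hD, mul_sub, Finset.sum_sub_distrib]
  have h3 : ∑ x, D x = (∑ x, (D x + D (reflect c x))) / 2 := by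
    rw [Finset.sum_add_distrib, sum_reflect]; ring
  have hm : ∀ z, Misordered c T z → 0 < D z + D (reflect c z) := by
    intro z hz
    have k1 : polarizeFun c T z = reflect c z := if_pos hz
    have hval : D z + D (reflect c z) =
        ((bvInv n z : ℝ) - (bvInv n (reflect c z) : ℝ)) *
          ((T (reflect c z) : ℝ) - (T z : ℝ)) := by
      simp only [hD, polarize_apply, polarizeFun_reflect, k1, reflect_reflect]
      ring
    rw [hval]
    have b1 : bvInv n (reflect c z) ≠ bvInv n z := fun h => hz.ne (bvInv_injective h)
    have b2 : T (reflect c z) ≠ T z := fun h => hz.ne (T.injective h)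
    unfold Misordered at hz
    rcases lt_or_gt_of_ne b1 with h1 | h1
    · have h5 : T z < T (reflect c z) := by simpa [h1.not_gt, h1.le] using hz
      have : (bvInv n (reflect c z) : ℝ) < (bvInv n z : ℝ) := by exact_mod_cast h1
      have : (T z : ℝ) < (T (reflect c z) : ℝ) := by exact_mod_cast h5
      exact mul_pos (by linarith) (by linarith)
    · have h5 : T (reflect c z) < T z := lt_of_le_of_ne (by simpa [h1] using hz) b2
      have : (bvInv n z : ℝ) < (bvInv n (reflect c z) : ℝ) := by exact_mod_cast h1
      have : (T (reflect c z) : ℝ) < (T z : ℝ) := by exact_mod_cast h5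
      exact mul_pos_of_neg_of_neg (by linarith) (by linarith)
  have h4 : 0 < ∑ x, (D x + D (reflect c x)) := by
    refine Finset.sum_pos' (fun z _ => ?_) ⟨x, Finset.mem_univ _, hm x hx⟩
    by_cases hz : Misordered c T z
    · exact (hm z hz).le
    · have k1 : polarizeFun c T z = z := if_neg hz
      simp [hD, polarize_apply, polarizeFun_reflect, k1]
  linarith

/-- `T ∘ S⁻¹` is an order automorphism of `Fin n`, and the identity is the only one. -/
theorem eq_of_lt_iff_lt {S T : Equiv.Perm (Fin n)} (h : ∀ x y, S x < S y ↔ T x < T y) :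
    S = T := by
  let e : Fin n ≃o Fin n := (S.symm.trans T).toOrderIso
    (fun a b hab => by
      have := h (S.symm b) (S.symm a)
      simp only [Equiv.apply_symm_apply] at this
      exact not_lt.1 fun hh => absurd (this.2 hh) (not_lt.2 hab))
    (fun a b hab => by
      have := h (T.symm b) (T.symm a)
      simp only [Equiv.apply_symm_apply] at this
      exact not_lt.1 fun hh => absurd (this.1 hh) (not_lt.2 hab))
  have he : e = OrderIso.refl _ := Subsingleton.elim _ _
  ext x
  have : T (S.symm (S x)) = S x := congrArg (fun f => f (S x)) he
  rw [← this, S.symm_apply_apply]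

/-- Among all numberings of the cycle, the zigzag maximizes the quadratic assignment functional of
a nondecreasing function of the time and a decreasing function of the distance. -/
theorem assignValue_le_zigzag {g : Fin n → ℝ} (hg : Monotone g) {F : ℕ → ℝ}
    (hF : IsCyclicDecreasing n F) (T : Equiv.Perm (Fin n)) :
    assignValue g F T ≤ assignValue g F (bvNumbering n).symm := by
  -- Polarization may leave the functional unchanged, so a maximizer of it alone could still be
  -- misordered; the correlation with the zigzag breaks the ties.
  obtain ⟨M, hM⟩ := Finite.exists_max
    fun T : Equiv.Perm (Fin n) => toLex (assignValue g F T, zigzagCorr T)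
  have hMT : ∀ T, assignValue g F T ≤ assignValue g F M := fun T => by
    have := hM T
    rw [Prod.Lex.toLex_le_toLex] at this
    rcases this with h | h
    · exact h.le
    · exact h.1.le
  have hno : ∀ c x, ¬ Misordered c M x := by
    intro c x hx
    have := hM (polarize c M)
    rw [Prod.Lex.toLex_le_toLex] at this
    have h1 := assignValue_le_polarize hg hF c M
    have h2 := zigzagCorr_lt_polarize hx
    dsimp only at this
    rcases this with h | h
    · linarith
    · linarith [h.2]
  have hMz : M = (bvNumbering n).symm := by
    refine eq_of_lt_iff_lt fun x y => ?_
    obtain ⟨c, rfl⟩ := exists_reflect_eq x y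
    exact not_not.1 (hno c x)
  exact hMz ▸ hMT T

end Polarization

/-! ### Regular polygons and antiprisms -/

theorem sin_le_sin_of_le_of_le_pi_sub {a x : ℝ} (ha : 0 ≤ a) (hax : a ≤ x)
    (hx : x ≤ Real.pi - a) : Real.sin a ≤ Real.sin x := by
  have h : Real.sin x - Real.sin a = 2 * Real.sin ((x - a) / 2) * Real.cos ((x + a) / 2) :=
    Real.sin_sub_sin x a
  have h1 : 0 ≤ Real.sin ((x - a) / 2) :=
    Real.sin_nonneg_of_nonneg_of_le_pi (by linarith) (by linarith)
  have h2 : 0 ≤ Real.cos ((x + a) / 2) :=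
    Real.cos_nonneg_of_neg_pi_div_two_le_of_le (by linarith) (by linarith)
  have := mul_nonneg (mul_nonneg zero_le_two h1) h2
  linarith

theorem cos_sub_cos_succ (n d : ℕ) :
    Real.cos (2 * Real.pi * d / n) - Real.cos (2 * Real.pi * (d + 1 : ℕ) / n) =
      2 * Real.sin ((2 * d + 1) * (Real.pi / n)) * Real.sin (Real.pi / n) := by
  rw [Real.cos_sub_cos]
  have h1 : (2 * Real.pi * d / n + 2 * Real.pi * (d + 1 : ℕ) / n) / 2 =
      (2 * d + 1) * (Real.pi / n) := by push_cast; ring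
  have h2 : (2 * Real.pi * d / n - 2 * Real.pi * (d + 1 : ℕ) / n) / 2 = -(Real.pi / n) := by
    push_cast; ring
  rw [h1, h2, Real.sin_neg]
  ring

/-- The right side is half the drop of the cosine from distance `d` to `d + 1`. By concavity of the
sine it is smallest at the ends of the range of odd `d`. If `4 ∣ n`, the last `d` has `2 * d + 1 = n
- 1`, and the bound is the square of `sin (π / n)`. If `n / 2` is odd, both ends give `sin (3 * π /
n)`, since then `2 * d + 1` runs from `3` to at most `n - 3`. -/
theorem sq_le_of_le_heightBound {n d : ℕ} {h : ℝ} (h0 : 0 < h) (hb : h ≤ heightBound n)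
    (hd : Odd d) (hdn : 2 * (d + 1) ≤ n) :
    h ^ 2 ≤ Real.sin ((2 * d + 1) * (Real.pi / n)) * Real.sin (Real.pi / n) := by
  have hn : (0 : ℝ) < n := by exact_mod_cast (show 0 < n by omega)
  have hpos : 0 ≤ Real.pi / n := by positivity
  have hsin : 0 ≤ Real.sin (Real.pi / n) :=
    Real.sin_nonneg_of_nonneg_of_le_pi hpos
      (div_le_self Real.pi_pos.le (by exact_mod_cast (show 1 ≤ n by omega)))
  have key : ∀ k : ℕ, k ≤ 2 * d + 1 → 2 * d + 1 + k ≤ n →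
      Real.sin (k * (Real.pi / n)) ≤ Real.sin ((2 * d + 1) * (Real.pi / n)) := by
    intro k hk hkn
    have hk' : (k : ℝ) ≤ 2 * d + 1 := by exact_mod_cast hk
    have hkn' : (2 * d + 1 + k : ℝ) ≤ n := by exact_mod_cast hkn
    refine sin_le_sin_of_le_of_le_pi_sub (by positivity)
      (mul_le_mul_of_nonneg_right hk' hpos) ?_
    have h1 := mul_le_mul_of_nonneg_right hkn' hpos
    have h2 : (n : ℝ) * (Real.pi / n) = Real.pi := by field_simp
    rw [h2] at h1
    linarith
  unfold heightBound at hb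
  split_ifs at hb with h1 h2
  · linarith
  · rw [Real.le_sqrt' h0] at hb
    have e := cos_sub_cos_succ n 0
    simp only [Nat.cast_zero, mul_zero, zero_div, Real.cos_zero, zero_add, Nat.cast_one,
      mul_one, one_mul] at e
    have := key 1 (by omega) (by omega)
    rw [Nat.cast_one, one_mul] at this
    have := mul_le_mul_of_nonneg_right this hsin
    linarith
  · rw [Real.le_sqrt' h0] at hb
    have e := cos_sub_cos_succ n 1
    norm_num only [Nat.cast_one, mul_one, Nat.cast_ofNat] at e
    rw [show 2 * Real.pi * 2 / n = 4 * Real.pi / n by ring] at e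
    rw [Nat.not_even_iff_odd] at h2
    rw [Nat.not_odd_iff_even] at h1
    have := key 3 (by obtain ⟨k, rfl⟩ := hd; omega) (by
      obtain ⟨a, rfl⟩ := hd; obtain ⟨b, hb⟩ := h2; obtain ⟨c, hc⟩ := h1; omega)
    have := mul_le_mul_of_nonneg_right this hsin
    push_cast at this
    linarith

/-- The scalar product of two unit antiprism vertices at distance `d`. -/
def antiprismKernel (n : ℕ) (h : ℝ) (d : ℕ) : ℝ :=
  Real.cos (2 * Real.pi * d / n) + (-1) ^ d * h ^ 2

/-- Symmetry needs `(-1) ^ (n - d) = (-1) ^ d`, which holds for even `n`; for odd `n` the height is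
zero. From an even `d` to `d + 1` both summands decrease. From an odd `d` the alternating summand
rises by `2 * h ^ 2`, which the cosine has to compensate. -/
theorem antiprismKernel_isCyclicDecreasing {n : ℕ} {h : ℝ} (h0 : 0 ≤ h)
    (hb : h ≤ heightBound n) : IsCyclicDecreasing n (antiprismKernel n h) where
  symm d hd hdn := by
    have hn : (n : ℝ) ≠ 0 := by exact_mod_cast (show n ≠ 0 by omega)
    unfold antiprismKernel
    congr 1
    · rw [Nat.cast_sub hdn.le, show 2 * Real.pi * ((n : ℝ) - d) / n =
        2 * Real.pi - 2 * Real.pi * d / n by field_simp, Real.cos_two_pi_sub]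
    · by_cases ho : Odd n
      · simp only [heightBound, ho, if_true] at hb
        simp [le_antisymm hb h0]
      · rw [Nat.not_odd_iff_even] at ho
        congr 1
        rcases Nat.even_or_odd d with hd' | hd'
        · rw [hd'.neg_one_pow, Even.neg_one_pow]
          exact (Nat.even_sub hdn.le).2 ⟨fun _ => hd', fun _ => ho⟩
        · rw [hd'.neg_one_pow, Odd.neg_one_pow]
          rw [← Nat.not_even_iff_odd, Nat.even_sub hdn.le]
          exact fun h => Nat.not_even_iff_odd.2 hd' (h.1 ho)
  anti d hd hdn := by
    have hn : (0 : ℝ) < n := by exact_mod_cast (show 0 < n by omega)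
    have e := cos_sub_cos_succ n d
    have hpos : 0 ≤ Real.pi / n := by positivity
    have hmul : (n : ℝ) * (Real.pi / n) = Real.pi := by field_simp
    have hs1 : 0 ≤ Real.sin (Real.pi / n) :=
      Real.sin_nonneg_of_nonneg_of_le_pi hpos
        (div_le_self Real.pi_pos.le (by exact_mod_cast (show 1 ≤ n by omega)))
    have hs2 : 0 ≤ Real.sin ((2 * d + 1) * (Real.pi / n)) := by
      refine Real.sin_nonneg_of_nonneg_of_le_pi (by positivity) ?_
      have : (2 * d + 1 : ℝ) ≤ n := by exact_mod_cast (show 2 * d + 1 ≤ n by omega)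
      have := mul_le_mul_of_nonneg_right this hpos
      linarith
    have hs := mul_nonneg hs2 hs1
    unfold antiprismKernel
    rcases Nat.even_or_odd d with hd' | hd'
    · rw [hd'.neg_one_pow, hd'.add_one.neg_one_pow]
      nlinarith [sq_nonneg h]
    · rw [hd'.neg_one_pow, hd'.add_one.neg_one_pow]
      rcases h0.eq_or_lt with rfl | h0
      · linarith
      · have := sq_le_of_le_heightBound h0 hb hd' hdn
        linarith

/-- The vertices of a regular polygon or of an antiprism. -/
def antiprismVertex (n : ℕ) (h : ℝ) (m : Fin n) : Fin 3 → ℝ :=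
  ![Real.cos (2 * Real.pi * m.val / n), Real.sin (2 * Real.pi * m.val / n), (-1) ^ m.val * h]

theorem antiprismVertex_dotProduct {n : ℕ} (h : ℝ) (x y : Fin n) :
    antiprismVertex n h x ⬝ᵥ antiprismVertex n h y = antiprismKernel n h (gap x y) := by
  wlog hxy : y.val ≤ x.val generalizing x y
  · rw [dotProduct_comm, gap_comm, this y x (by omega)]
  have hg : gap x y = x.val - y.val := by unfold gap; omega
  rw [hg]
  simp only [antiprismVertex, antiprismKernel, dotProduct, Fin.sum_univ_three, Matrix.cons_val]
  rw [Nat.cast_sub hxy, mul_sub, sub_div, Real.cos_sub]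
  have : (-1 : ℝ) ^ x.val * (-1) ^ y.val = (-1) ^ (x.val - y.val) := by
    rw [← pow_add, show x.val + y.val = x.val - y.val + 2 * y.val by omega, pow_add, pow_mul]
    simp
  rw [← this]
  ring

theorem sum_sq_weighted_vertices {n : ℕ} (g : Fin n → ℝ) (h : ℝ) (ν : Equiv.Perm (Fin n)) :
    ∑ k, (∑ t, g t * antiprismVertex n h (ν t) k) ^ 2 =
      assignValue g (antiprismKernel n h) ν.symm := by
  have e : ∀ k, ∑ t, g t * antiprismVertex n h (ν t) k =
      ∑ x, g (ν.symm x) * antiprismVertex n h x k := fun k => by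
    simpa using Equiv.sum_comp ν fun x => g (ν.symm x) * antiprismVertex n h x k
  simp only [e, sq, Finset.sum_mul_sum, assignValue]
  rw [Finset.sum_comm]
  refine Finset.sum_congr rfl fun x _ => ?_
  rw [Finset.sum_comm]
  refine Finset.sum_congr rfl fun y _ => ?_
  rw [← antiprismVertex_dotProduct, dotProduct, Finset.mul_sum]
  exact Finset.sum_congr rfl fun k _ => by ring

open scoped ComplexOrder

/-! ### Traces -/

section Trace

variable {H : Type*} [NormedAddCommGroup H] [InnerProductSpace ℂ H]

/-- The trace as a linear functional. -/
def trLin (H : Type*) [NormedAddCommGroup H] [InnerProductSpace ℂ H] : Op H →ₗ[ℂ] ℂ :=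
  LinearMap.trace ℂ H ∘ₗ ContinuousLinearMap.coeLM ℂ

theorem trLin_apply (A : Op H) : trLin H A = tr A := rfl

theorem tr_add (A B : Op H) : tr (A + B) = tr A + tr B := map_add (trLin H) A B

theorem tr_sub (A B : Op H) : tr (A - B) = tr A - tr B := map_sub (trLin H) A B

theorem tr_neg (A : Op H) : tr (-A) = -tr A := map_neg (trLin H) A

theorem tr_zero : tr (0 : Op H) = 0 := map_zero (trLin H)

theorem tr_smul (c : ℂ) (A : Op H) : tr (c • A) = c * tr A := map_smul (trLin H) c A

theorem tr_sum {ι : Type*} (s : Finset ι) (A : ι → Op H) :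
    tr (∑ i ∈ s, A i) = ∑ i ∈ s, tr (A i) := map_sum (trLin H) A s

theorem tr_mul_comm (A B : Op H) : tr (A * B) = tr (B * A) :=
  LinearMap.trace_mul_comm ℂ (A : H →ₗ[ℂ] H) (B : H →ₗ[ℂ] H)

theorem tr_rankOne_mul [FiniteDimensional ℂ H] (u v : H) (A : Op H) :
    tr (InnerProductSpace.rankOne ℂ u v * A) = inner ℂ v (A u) := by
  rw [tr_mul_comm, ContinuousLinearMap.mul_def, InnerProductSpace.comp_rankOne]
  exact InnerProductSpace.trace_rankOne _ _

theorem tr_rankOne [FiniteDimensional ℂ H] (u v : H) :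
    tr (InnerProductSpace.rankOne ℂ u v) = inner ℂ v u :=
  InnerProductSpace.trace_rankOne _ _

theorem tr_nonneg {A : Op H} (hA : A.IsPositive) : 0 ≤ tr A :=
  LinearMap.IsPositive.trace_nonneg (ContinuousLinearMap.isPositive_toLinearMap_iff A |>.2 hA)

variable [FiniteDimensional ℂ H]

/-- A positive operator pairs with every operator as a sum of vector states. -/
theorem exists_tr_mul_eq_sum {A : Op H} (hA : A.IsPositive) :
    ∃ (d : ℕ) (u : Fin d → H), ∀ B : Op H, tr (A * B) = ∑ i, inner ℂ (u i) (B (u i)) := by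
  obtain ⟨d, u, rfl⟩ := ContinuousLinearMap.isPositive_iff_eq_sum_rankOne.1 hA
  refine ⟨d, u, fun B => ?_⟩
  rw [Finset.sum_mul, tr_sum]
  exact Finset.sum_congr rfl fun i _ => tr_rankOne_mul _ _ _

theorem tr_mul_nonneg {A B : Op H} (hA : A.IsPositive) (hB : B.IsPositive) :
    0 ≤ tr (A * B) := by
  obtain ⟨d, u, h⟩ := exists_tr_mul_eq_sum hA
  rw [h]
  exact Finset.sum_nonneg fun i _ => hB.inner_nonneg_right _

theorem tr_one (hH : Module.finrank ℂ H = 2) : tr (1 : Op H) = 2 := by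
  have : tr (1 : Op H) = Module.finrank ℂ H := LinearMap.trace_one ℂ H
  rw [this, hH]; norm_num

end Trace

/-! ### Operators on a qubit -/

section Qubit

variable {H : Type*} [NormedAddCommGroup H] [InnerProductSpace ℂ H] [FiniteDimensional ℂ H]

/-- Cayley–Hamilton for a traceless two-by-two matrix, with the determinant expressed by the trace
of the square. -/
theorem mul_self_of_tr_eq_zero (hH : Module.finrank ℂ H = 2) {A : Op H} (hA : tr A = 0) :
    A * A = (tr (A * A) / 2) • 1 := by
  let b := Module.finBasisOfFinrankEq ℂ H hH
  have key : ∀ f : H →ₗ[ℂ] H, LinearMap.trace ℂ H f = 0 →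
      f * f = (LinearMap.trace ℂ H (f * f) / 2) • (1 : H →ₗ[ℂ] H) := by
    intro f hf
    apply (LinearMap.toMatrix b b).injective
    rw [LinearMap.trace_eq_matrix_trace ℂ b, map_smul, LinearMap.toMatrix_mul,
      LinearMap.toMatrix_one]
    rw [LinearMap.trace_eq_matrix_trace ℂ b] at hf
    generalize LinearMap.toMatrix b b f = M at *
    rw [Matrix.trace_fin_two] at hf
    have h1 : M 1 1 = - M 0 0 := by linear_combination hf
    ext i j
    fin_cases i <;> fin_cases j <;>
      simp [Matrix.mul_apply, Matrix.trace_fin_two, Fin.sum_univ_two, h1] <;> ring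
  exact ContinuousLinearMap.coe_injective (key A hA)

theorem mul_add_mul_of_tr_eq_zero (hH : Module.finrank ℂ H = 2) {A B : Op H} (hA : tr A = 0)
    (hB : tr B = 0) : A * B + B * A = tr (A * B) • 1 := by
  have h1 := mul_self_of_tr_eq_zero hH hA
  have h2 := mul_self_of_tr_eq_zero hH hB
  have h3 := mul_self_of_tr_eq_zero hH (A := A + B) (by rw [tr_add, hA, hB, add_zero])
  have h4 : tr ((A + B) * (A + B)) = tr (A * A) + tr (B * B) + 2 * tr (A * B) := by
    rw [add_mul, mul_add, mul_add, tr_add, tr_add, tr_add, tr_mul_comm B A]; ring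
  rw [h4] at h3
  have h5 : A * B + B * A = (A + B) * (A + B) - A * A - B * B := by noncomm_ring
  rw [h5, h3, h1, h2, tr_smul, tr_smul, tr_one hH]
  module

variable [CompleteSpace H]

theorem tr_mul_self_nonneg {A : Op H} (hA : IsSelfAdjoint A) : 0 ≤ tr (A * A) := by
  refine tr_nonneg ?_
  have := ContinuousLinearMap.isPositive_adjoint_comp_self A
  rwa [← ContinuousLinearMap.star_eq_adjoint, hA.star_eq] at this

theorem eq_zero_of_tr_mul_self {A : Op H} (hH : Module.finrank ℂ H = 2) (hA : IsSelfAdjoint A)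
    (h0 : tr A = 0) (h : tr (A * A) = 0) : A = 0 := by
  have h1 := mul_self_of_tr_eq_zero hH h0
  rw [h, zero_div, zero_smul] at h1
  rw [← CStarRing.star_mul_self_eq_zero_iff, hA.star_eq, h1]

/-- The positive eigenvalue of a traceless Hermitian operator on a qubit. -/
def radius (A : Op H) : ℝ := √((tr (A * A)).re / 2)

theorem radius_nonneg (A : Op H) : 0 ≤ radius A := Real.sqrt_nonneg _

theorem radius_neg (A : Op H) : radius (-A) = radius A := by simp [radius]

theorem tr_mul_self_eq_radius {A : Op H} (hA : IsSelfAdjoint A) :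
    tr (A * A) = 2 * (radius A : ℂ) ^ 2 := by
  have h := tr_mul_self_nonneg hA
  rw [Complex.nonneg_iff] at h
  have h2 : radius A ^ 2 = (tr (A * A)).re / 2 := Real.sq_sqrt (by linarith)
  apply Complex.ext
  · rw [← Complex.ofReal_pow, h2]; simp; ring
  · rw [← h.2, ← Complex.ofReal_pow, h2]; simp

theorem mul_self_eq_radius (hH : Module.finrank ℂ H = 2) {A : Op H} (hA : IsSelfAdjoint A)
    (h0 : tr A = 0) : A * A = ((radius A : ℂ) ^ 2) • 1 := by
  rw [mul_self_of_tr_eq_zero hH h0, tr_mul_self_eq_radius hA]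
  congr 1; ring

theorem eq_zero_of_radius (hH : Module.finrank ℂ H = 2) {A : Op H} (hA : IsSelfAdjoint A)
    (h0 : tr A = 0) (hr : radius A = 0) : A = 0 :=
  eq_zero_of_tr_mul_self hH hA h0 (by rw [tr_mul_self_eq_radius hA, hr]; simp)

/-- The measurement operator `Π₋ + Π₀ / 2` of a traceless Hermitian operator on a qubit. -/
def halfSpace (A : Op H) : Op H := (1 / 2 : ℂ) • (1 - ((radius A : ℂ)⁻¹) • A)

theorem isSelfAdjoint_ofReal_smul {A : Op H} (hA : IsSelfAdjoint A) (c : ℝ) :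
    IsSelfAdjoint ((c : ℂ) • A) := by
  rw [IsSelfAdjoint, star_smul, hA.star_eq]; simp

theorem isSelfAdjoint_halfSpace {A : Op H} (hA : IsSelfAdjoint A) :
    IsSelfAdjoint (halfSpace A) := by
  have h1 : IsSelfAdjoint ((radius A : ℂ)⁻¹ • A) := by
    rw [← Complex.ofReal_inv]; exact isSelfAdjoint_ofReal_smul hA _
  have := isSelfAdjoint_ofReal_smul ((IsSelfAdjoint.one (Op H)).sub h1) (1 / 2)
  simpa [halfSpace] using this

theorem halfSpace_mul_self (hH : Module.finrank ℂ H = 2) {A : Op H} (hA : IsSelfAdjoint A)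
    (h0 : tr A = 0) (hr : radius A ≠ 0) : halfSpace A * halfSpace A = halfSpace A := by
  have hr' : (radius A : ℂ) ≠ 0 := by exact_mod_cast hr
  have h1 : ((radius A : ℂ)⁻¹ • A) * ((radius A : ℂ)⁻¹ • A) = 1 := by
    rw [smul_mul_smul_comm, mul_self_eq_radius hH hA h0, smul_smul]
    field_simp
    simp
  unfold halfSpace
  generalize (radius A : ℂ)⁻¹ • A = B at *
  rw [smul_mul_smul_comm, show (1 - B) * (1 - B) = 1 - 2 * B + B * B by noncomm_ring, h1,
    two_mul]
  module

theorem isPositive_halfSpace (hH : Module.finrank ℂ H = 2) {A : Op H} (hA : IsSelfAdjoint A)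
    (h0 : tr A = 0) : (halfSpace A).IsPositive := by
  by_cases hr : radius A = 0
  -- Here `A = 0`, and the convention `0⁻¹ = 0` yields half the identity, matching `Π₀ / 2`.
  · have : halfSpace A = (1 / 2 : ℂ) • 1 := by simp [halfSpace, hr]
    rw [this]
    exact ContinuousLinearMap.isPositive_one.smul_of_nonneg (by
      rw [Complex.nonneg_iff]; norm_num)
  · have := ContinuousLinearMap.isPositive_adjoint_comp_self (halfSpace A)
    rwa [← ContinuousLinearMap.star_eq_adjoint, (isSelfAdjoint_halfSpace hA).star_eq,
      ← ContinuousLinearMap.mul_def, halfSpace_mul_self hH hA h0 hr] at this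

theorem halfSpace_add_halfSpace_neg (A : Op H) : halfSpace A + halfSpace (-A) = 1 := by
  unfold halfSpace
  rw [radius_neg]
  module

theorem tr_halfSpace_mul {A : Op H} (hA : IsSelfAdjoint A) (h0 : tr A = 0) :
    tr (halfSpace A * A) = -(radius A : ℂ) := by
  unfold halfSpace
  rw [smul_mul_assoc, sub_mul, one_mul, smul_mul_assoc, tr_smul, tr_sub, tr_smul, h0,
    tr_mul_self_eq_radius hA]
  by_cases hr : (radius A : ℂ) = 0
  · simp [hr]
  · field_simp; ring

/-- The operator equals `2 * radius A` times the projection `halfSpace (-A)` on the positive part.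
-/
theorem isPositive_add_radius (hH : Module.finrank ℂ H = 2) {A : Op H} (hA : IsSelfAdjoint A)
    (h0 : tr A = 0) : (A + (radius A : ℂ) • 1).IsPositive := by
  by_cases hr : radius A = 0
  · rw [hr, eq_zero_of_radius hH hA h0 hr]
    simp [ContinuousLinearMap.isPositive_zero]
  · have h1 := (isPositive_halfSpace hH (A := -A) hA.neg (by rw [tr_neg, h0, neg_zero]))
    have h2 := h1.smul_of_nonneg (c := ((2 * radius A : ℝ) : ℂ)) (by
      have := radius_nonneg A
      rw [Complex.zero_le_real]; positivity)
    have hr' : (radius A : ℂ) ≠ 0 := by exact_mod_cast hr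
    convert h2 using 1
    unfold halfSpace
    rw [radius_neg, smul_neg, sub_neg_eq_add, smul_smul, smul_add, smul_smul]
    push_cast
    rw [show 2 * (radius A : ℂ) * (1 / 2) = radius A by ring, mul_inv_cancel₀ hr', one_smul,
      add_comm]

theorem projNeg_add_half_projNull (hH : Module.finrank ℂ H = 2) {A : Op H}
    (hA : IsSelfAdjoint A) (h0 : tr A = 0) :
    projNeg A + (1 / 2 : ℂ) • projNull A = halfSpace A := by
  by_cases hr : radius A = 0
  · have hA0 := eq_zero_of_radius hH hA h0 hr
    subst hA0
    have h1 : (⨆ μ : {x : ℝ // x < 0},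
        Module.End.eigenspace ((0 : Op H) : H →ₗ[ℂ] H) ((μ : ℝ) : ℂ)) = ⊥ := by
      rw [iSup_eq_bot]
      rintro ⟨x, hx⟩
      rw [Submodule.eq_bot_iff]
      intro v hv
      rw [Module.End.mem_eigenspace_iff] at hv
      simpa [hx.ne] using hv.symm
    have h2 : LinearMap.ker ((0 : Op H) : H →ₗ[ℂ] H) = ⊤ := by
      rw [ContinuousLinearMap.toLinearMap_zero]; exact LinearMap.ker_zero
    unfold projNeg projNull
    simp only [h1, h2, Submodule.starProjection_bot, Submodule.starProjection_top']
    simp [halfSpace]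
  · have hr' : (radius A : ℂ) ≠ 0 := by exact_mod_cast hr
    have hrpos : 0 < radius A := lt_of_le_of_ne (radius_nonneg A) (Ne.symm hr)
    have hAA := mul_self_eq_radius hH hA h0
    have hAAv : ∀ v, A (A v) = ((radius A : ℂ) ^ 2) • v := fun v => by
      have := congrArg (fun f : Op H => f v) hAA
      simpa using this
    have hker : LinearMap.ker (A : H →ₗ[ℂ] H) = ⊥ := by
      rw [Submodule.eq_bot_iff]
      intro v hv
      have h1 : A v = 0 := hv
      have h2 := hAAv v
      rw [h1, map_zero] at h2
      simpa [hr'] using h2.symm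
    -- From `A ^ 2 = radius ^ 2` an eigenvalue is `± radius`, so only one negative eigenspace is
    -- nonzero.
    have hsup : (⨆ μ : {x : ℝ // x < 0},
        Module.End.eigenspace (A : H →ₗ[ℂ] H) ((μ : ℝ) : ℂ)) =
        Module.End.eigenspace (A : H →ₗ[ℂ] H) ((-radius A : ℝ) : ℂ) := by
      apply le_antisymm
      · refine iSup_le ?_
        rintro ⟨x, hx⟩ v hv
        rw [Module.End.mem_eigenspace_iff] at hv ⊢
        have hv' : A v = (x : ℂ) • v := hv
        by_cases hv0 : v = 0
        · simp [hv0]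
        have h2 := hAAv v
        rw [hv', map_smul, hv', smul_smul] at h2
        have h3 := smul_left_injective ℂ hv0 h2
        have h4 : x * x = radius A ^ 2 := by exact_mod_cast h3
        have h5 : x = -radius A := by nlinarith
        rw [← h5]; exact hv
      · exact le_iSup (fun μ : {x : ℝ // x < 0} =>
          Module.End.eigenspace (A : H →ₗ[ℂ] H) ((μ : ℝ) : ℂ)) ⟨-radius A, by linarith⟩
    have hP : IsStarProjection (halfSpace A) :=
      ⟨halfSpace_mul_self hH hA h0 hr, isSelfAdjoint_halfSpace hA⟩
    have happ : ∀ v, halfSpace A v = (1 / 2 : ℂ) • (v - (radius A : ℂ)⁻¹ • A v) := fun v => rfl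
    unfold projNeg projNull
    simp only [hsup, hker, Submodule.starProjection_bot, smul_zero, add_zero]
    ext v
    refine (Submodule.eq_starProjection_of_mem_orthogonal (u := v) (v := halfSpace A v) ?_ ?_)
    · rw [Module.End.mem_eigenspace_iff]
      change A (halfSpace A v) = _
      rw [happ, map_smul, map_sub, map_smul, hAAv]
      simp only [Complex.ofReal_neg, smul_sub, smul_smul]
      field_simp
      module
    · rw [Submodule.mem_orthogonal]
      intro w hw
      rw [Module.End.mem_eigenspace_iff] at hw
      have hw' : A w = ((-radius A : ℝ) : ℂ) • w := hw
      have h1 : halfSpace A w = w := by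
        rw [happ, hw', smul_smul]
        push_cast
        rw [mul_neg, inv_mul_cancel₀ hr']
        module
      have h2 : inner ℂ (halfSpace A w) (v - halfSpace A v) = 0 := by
        have h3 : inner ℂ (halfSpace A w) (v - halfSpace A v) =
            inner ℂ w (halfSpace A (v - halfSpace A v)) := by
          rw [← ContinuousLinearMap.adjoint_inner_right, ← ContinuousLinearMap.star_eq_adjoint,
            (isSelfAdjoint_halfSpace hA).star_eq]
        have h4 : halfSpace A (halfSpace A v) = halfSpace A v :=
          congrArg (fun f : Op H => f v) (halfSpace_mul_self hH hA h0 hr)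
        rw [h3, map_sub, h4, sub_self, inner_zero_right]
      rwa [h1] at h2

/-- Parseval's identity for the Pauli vector of a traceless Hermitian operator. -/
theorem tr_mul_self_eq_sum_pauliVec (hH : Module.finrank ℂ H = 2) {s : Fin 3 → Op H}
    (hs : IsPauliBasis s) {A : Op H} (hA : IsSelfAdjoint A) (h0 : tr A = 0) :
    (tr (A * A)).re = ∑ k, pauliVec s A k ^ 2 := by
  set B : Op H := A - ∑ k, tr (A * s k) • s k with hB
  have hBs : ∀ l, tr (B * s l) = 0 := by
    intro l
    rw [hB, sub_mul, tr_sub, Finset.sum_mul, tr_sum]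
    simp only [smul_mul_assoc, tr_smul, hs.orthonormal]
    simp
  -- Polarization of the quadratic form `tr (X * X)`, which is real on Hermitian operators, shows
  -- that these coefficients are real.
  have hreal : ∀ k, tr (A * s k) = ((pauliVec s A k : ℝ) : ℂ) := by
    intro k
    have h1 := tr_mul_self_nonneg (hA.add (hs.selfAdjoint k))
    have h2 := tr_mul_self_nonneg hA
    have h3 := tr_mul_self_nonneg (hs.selfAdjoint k)
    rw [Complex.nonneg_iff] at h1 h2 h3
    have h4 : tr ((A + s k) * (A + s k)) = tr (A * A) + tr (s k * s k) + 2 * tr (A * s k) := by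
      rw [add_mul, mul_add, mul_add, tr_add, tr_add, tr_add, tr_mul_comm (s k) A]; ring
    have h5 := congrArg Complex.im h4
    simp [← h1.2, ← h2.2, ← h3.2] at h5
    exact Complex.ext rfl (by simpa using h5)
  have hB1 : tr B = 0 := by
    rw [hB, tr_sub, tr_sum, h0]
    simp [tr_smul, hs.traceless]
  have hBsa : IsSelfAdjoint B := by
    refine hA.sub (isSelfAdjoint_sum _ fun k _ => ?_)
    rw [hreal]; exact isSelfAdjoint_ofReal_smul (hs.selfAdjoint k) _
  have hB0 : B = 0 := by
    by_contra hne
    have hBB : tr (B * B) ≠ 0 := fun h => hne (eq_zero_of_tr_mul_self hH hBsa hB1 h)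
    -- A nonzero remainder `B` would give five mutually orthogonal operators with nonzero squares in
    -- a space of dimension four.
    let X : Fin 5 → Op H := ![1, s 0, s 1, s 2, B]
    have hX : ∀ i j, i ≠ j → tr (X i * X j) = 0 := by
      intro i j hij
      have e1 := hs.orthonormal
      have e2 := fun l => (tr_mul_comm (s l) B).trans (hBs l)
      fin_cases i <;> fin_cases j <;>
        first
        | exact absurd rfl hij
        | simp [X, hs.traceless, hB1, e1, e2, hBs]
    have hX' : ∀ i, tr (X i * X i) ≠ 0 := by
      intro i
      have e1 := hs.orthonormal
      fin_cases i <;> simp [X, e1, hBB, tr_one hH]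
    have hli : LinearIndependent ℂ X := by
      rw [Fintype.linearIndependent_iff]
      intro c hc i
      have h1 : tr ((∑ j, c j • X j) * X i) = 0 := by rw [hc, zero_mul, tr_zero]
      rw [Finset.sum_mul, tr_sum, Finset.sum_eq_single i] at h1
      · rw [smul_mul_assoc, tr_smul] at h1
        exact (mul_eq_zero.1 h1).resolve_right (hX' i)
      · intro j _ hji
        rw [smul_mul_assoc, tr_smul, hX j i hji, mul_zero]
      · simp
    have hli2 : LinearIndependent ℂ fun i => ContinuousLinearMap.coeLM ℂ (X i) :=
      hli.map' (ContinuousLinearMap.coeLM ℂ)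
        (LinearMap.ker_eq_bot.2 ContinuousLinearMap.coe_injective)
    have := hli2.fintype_card_le_finrank
    rw [Module.finrank_linearMap, hH] at this
    simp at this
  have hAeq : A = ∑ k, tr (A * s k) • s k := sub_eq_zero.1 hB0
  have h1 : tr (A * A) = ∑ k, tr (A * s k) * tr (A * s k) := by
    calc tr (A * A) = tr (A * ∑ k, tr (A * s k) • s k) := congrArg (fun X => tr (A * X)) hAeq
      _ = _ := by simp only [Finset.mul_sum, tr_sum, mul_smul_comm, tr_smul]
  rw [h1]
  simp only [hreal, ← Complex.ofReal_mul, ← Complex.ofReal_sum, Complex.ofReal_re, sq]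

end Qubit

/-! ### A bound on the cost of families of positive functionals -/

section Bound

variable {H : Type*} [NormedAddCommGroup H] [InnerProductSpace ℂ H]
variable {n : ℕ} {γ : Fin n → ℝ} {ρ : Fin n → Op H}

/-- Balancedness says that `σ⁻¹` negates the centred cost, and composing the numbering with `σ`
amounts to composing the cost with `σ⁻¹`. -/
theorem effOp_mul_of_isBalancedBy {σ : Equiv.Perm (Fin n)} (hσ : IsBalancedBy γ σ)
    (ν : Equiv.Perm (Fin n)) : effOp γ ρ (ν * σ) = -effOp γ ρ ν := by
  unfold effOp
  rw [← smul_neg, ← Finset.sum_neg_distrib]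
  congr 1
  rw [← Equiv.sum_comp σ⁻¹]
  refine Finset.sum_congr rfl fun t _ => ?_
  have h1 : γ (σ⁻¹ t) - avg γ = -(γ t - avg γ) := by have := hσ t; linarith
  rw [Equiv.Perm.mul_apply, show σ (σ⁻¹ t) = t from σ.apply_symm_apply t, h1, Complex.ofReal_neg, neg_smul]

theorem sum_sub_avg (γ : Fin n → ℝ) : ∑ t, (γ t - avg γ) = 0 := by
  rcases Nat.eq_zero_or_pos n with rfl | hn
  · simp
  have : (n : ℝ) ≠ 0 := by exact_mod_cast hn.ne'
  simp only [Finset.sum_sub_distrib, avg, Finset.sum_const, Finset.card_univ, Fintype.card_fin,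
    nsmul_eq_mul]
  field_simp
  ring

theorem tr_effOp {c : ℂ} (hρ : ∀ m, tr (ρ m) = c) (ν : Equiv.Perm (Fin n)) :
    tr (effOp γ ρ ν) = 0 := by
  unfold effOp
  simp only [tr_smul, tr_sum, hρ]
  rw [← Finset.sum_mul, ← Complex.ofReal_sum, sum_sub_avg]
  simp

/-- Each `ν i` is a bijection, so the probabilities of all times add up to one, and centring the
cost subtracts exactly `avg γ`. The halving undoes the factor two in `effOp`. -/
theorem cost_eq_avg_add {ι : Type*} [Fintype ι] (hρ : ∑ m, tr (ρ m) = 1)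
    {φ : ι → Op H →ₗ[ℂ] ℂ} (hφ : ∀ X, ∑ i, φ i X = tr X) (ν : ι → Equiv.Perm (Fin n)) :
    ∑ t, γ t * ∑ i, (φ i (ρ (ν i t))).re =
      avg γ + (∑ i, (φ i (effOp γ ρ (ν i))).re) / 2 := by
  have h1 : ∑ t, ∑ i, (φ i (ρ (ν i t))).re = 1 := by
    rw [Finset.sum_comm]
    have : ∀ i, ∑ t, (φ i (ρ (ν i t))).re = ∑ m, (φ i (ρ m)).re := fun i =>
      Equiv.sum_comp (ν i) fun m => (φ i (ρ m)).re
    simp only [this]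
    rw [Finset.sum_comm]
    simp only [← Complex.re_sum, hφ, hρ, Complex.one_re]
  have h2 : ∀ i, (φ i (effOp γ ρ (ν i))).re =
      2 * ∑ t, (γ t - avg γ) * (φ i (ρ (ν i t))).re := by
    intro i
    unfold effOp
    simp only [map_smul, map_sum, smul_eq_mul]
    rw [show (2 : ℂ) = ((2 : ℝ) : ℂ) by norm_num, Complex.re_ofReal_mul, Complex.re_sum]
    simp only [Complex.re_ofReal_mul]
  have h3 : ∑ i, ∑ t, (γ t - avg γ) * (φ i (ρ (ν i t))).re =
      ∑ t, γ t * ∑ i, (φ i (ρ (ν i t))).re - avg γ := by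
    rw [Finset.sum_comm]
    simp only [← Finset.mul_sum, sub_mul, Finset.sum_sub_distrib, h1, mul_one]
  simp only [h2, ← Finset.mul_sum, h3]
  ring

variable [FiniteDimensional ℂ H] [CompleteSpace H]

theorem isSelfAdjoint_effOp (hρ : ∀ m, (ρ m).IsPositive) (ν : Equiv.Perm (Fin n)) :
    IsSelfAdjoint (effOp γ ρ ν) := by
  unfold effOp
  rw [show (2 : ℂ) = ((2 : ℝ) : ℂ) by norm_num]
  exact isSelfAdjoint_ofReal_smul (isSelfAdjoint_sum _ fun t _ =>
    isSelfAdjoint_ofReal_smul (hρ _).isSelfAdjoint _) 2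

theorem neg_radius_mul_le (hH : Module.finrank ℂ H = 2) {φ : Op H →ₗ[ℂ] ℂ}
    (hφ : ∀ X : Op H, X.IsPositive → 0 ≤ φ X) {A : Op H} (hA : IsSelfAdjoint A)
    (h0 : tr A = 0) : -(radius A * (φ 1).re) ≤ (φ A).re := by
  have h := hφ _ (isPositive_add_radius hH hA h0)
  rw [Complex.nonneg_iff, map_add, map_smul, smul_eq_mul, Complex.add_re,
    Complex.re_ofReal_mul] at h
  linarith [h.1]

theorem avg_sub_le_cost (hH : Module.finrank ℂ H = 2) {ι : Type*} [Fintype ι]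
    (hρ : IsEnsemble ρ) {c : ℂ} (hc : ∀ m, tr (ρ m) = c)
    {φ : ι → Op H →ₗ[ℂ] ℂ} (hφ0 : ∀ i (X : Op H), X.IsPositive → 0 ≤ φ i X)
    (hφ : ∀ X, ∑ i, φ i X = tr X) (ν : ι → Equiv.Perm (Fin n)) {a : ℝ}
    (ha : ∀ i, radius (effOp γ ρ (ν i)) ≤ a) :
    avg γ - a ≤ ∑ t, γ t * ∑ i, (φ i (ρ (ν i t))).re := by
  rw [cost_eq_avg_add hρ.sum_trace hφ]
  have h1 : ∀ i, -(a * (φ i 1).re) ≤ (φ i (effOp γ ρ (ν i))).re := fun i => by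
    have h2 := neg_radius_mul_le hH (hφ0 i) (isSelfAdjoint_effOp (γ := γ) hρ.nonneg (ν i))
      (tr_effOp hc (ν i))
    have h3 := (Complex.nonneg_iff.1 (hφ0 i 1 ContinuousLinearMap.isPositive_one)).1
    have h4 := mul_le_mul_of_nonneg_right (ha i) h3
    linarith
  have h2 := Finset.sum_le_sum fun i (_ : i ∈ Finset.univ) => h1 i
  rw [Finset.sum_neg_distrib, ← Finset.mul_sum, ← Complex.re_sum, hφ, tr_one hH] at h2
  norm_num at h2
  linarith

end Bound

/-! ### Sequential strategies cost at least as much as numbering-valued measurements -/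

section Sequential

variable {n : ℕ} {H : Type*} [NormedAddCommGroup H] [InnerProductSpace ℂ H] [CompleteSpace H]

/-- The unnormalized state as a linear function of the initial operator. -/
def Strategy.runLin (S : Strategy n H) :
    (t : ℕ) → (Fin (t + 1) → Fin n) → Op H →ₗ[ℂ] Op (Q (S.dim t))
  | 0, m => (S.first.op (m 0)).toLinearMap
  | t + 1, m => ((S.next t).op (m (Fin.last (t + 1)))).toLinearMap ∘ₗ
      S.runLin t (fun s => m s.castSucc)

theorem Strategy.runLin_apply (S : Strategy n H) (t : ℕ) (m : Fin (t + 1) → Fin n) (X : Op H) :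
    S.runLin t m X = S.run t m X := by
  induction t with
  | zero => rfl
  | succ t ih => exact congrArg _ (ih _)

theorem Strategy.isPositive_run (S : Strategy n H) (t : ℕ) (m : Fin (t + 1) → Fin n) {X : Op H}
    (hX : X.IsPositive) : (S.run t m X).IsPositive := by
  induction t with
  | zero =>
    rw [← ContinuousLinearMap.nonneg_iff_isPositive] at hX ⊢
    exact map_nonneg (S.first.op (m 0)) hX
  | succ t ih =>
    have := ih fun s => m s.castSucc
    rw [← ContinuousLinearMap.nonneg_iff_isPositive] at this ⊢
    exact map_nonneg ((S.next t).op _) this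

/-- The instruments preserve the trace, so the outcomes after time `t` can be summed out. This puts
the probabilities for all times on one space of complete outcome sequences. -/
theorem Strategy.sum_tr_run (S : Strategy n H) {t N : ℕ} (htN : t ≤ N)
    (f : (Fin (t + 1) → Fin n) → Op H) :
    ∑ m : Fin (t + 1) → Fin n, tr (S.run t m (f m)) =
      ∑ m : Fin (N + 1) → Fin n,
        tr (S.run N m (f fun s => m (Fin.castLE (Nat.succ_le_succ htN) s))) := by
  induction N, htN using Nat.le_induction with
  | base => rfl
  | succ N htN ih =>
    rw [ih, ← Equiv.sum_comp (Fin.snocEquiv fun _ : Fin (N + 2) => Fin n),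
      Fintype.sum_prod_type, Finset.sum_comm]
    refine Finset.sum_congr rfl fun m _ => ?_
    rw [← (S.next N).trace_preserving]
    refine Finset.sum_congr rfl fun a _ => ?_
    simp only [Strategy.run, Fin.snocEquiv_apply, Fin.snoc_last, Fin.snoc_castSucc]
    congr 4
    funext s
    exact (Fin.snoc_castSucc (α := fun _ => Fin n) a m
      (Fin.castLE (Nat.succ_le_succ htN) s)).symm

theorem Strategy.sum_tr_run_const (S : Strategy n H) (N : ℕ) (X : Op H) :
    ∑ m : Fin (N + 1) → Fin n, tr (S.run N m X) = tr X := by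
  rw [← S.sum_tr_run (Nat.zero_le N) fun _ => X, ← S.first.trace_preserving X]
  exact Fintype.sum_equiv (Equiv.funUnique (Fin 1) (Fin n)) _ _ fun m => rfl

/-- The query at time `t` differs from the earlier ones. -/
def IsNewAt {α : Type*} (m : Fin n → α) (t : Fin n) : Prop := ∀ s < t, m s ≠ m t

/-- The sequence is injective on the times of new queries, and a partial injection of a finite set
extends to a permutation. -/
theorem exists_perm_eq_of_isNewAt (m : Fin n → Fin n) :
    ∃ ν : Equiv.Perm (Fin n), ∀ t, IsNewAt m t → ν t = m t := by
  classical
  have hinj : Set.InjOn m {t | IsNewAt m t} := by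
    intro a ha b hb hab
    rcases lt_trichotomy a b with h | h | h
    · exact absurd hab (hb a h)
    · exact h
    · exact absurd hab.symm (ha b h)
  let e : {t // t ∈ {t | IsNewAt m t}} ≃ {l // l ∈ m '' {t | IsNewAt m t}} :=
    Equiv.Set.imageOfInjOn m _ hinj
  exact ⟨e.extendSubtype, fun t ht => e.extendSubtype_apply_of_mem t ht⟩

open Classical in
theorem Strategy.prob_eq {N : ℕ} (S : Strategy (N + 1) H) (ρ : Fin (N + 1) → Op H)
    (t : Fin (N + 1)) :
    S.prob ρ t = ∑ m : Fin (N + 1) → Fin (N + 1),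
      if IsNewAt m t then (tr (S.run N m (ρ (m t)))).re else 0 := by
  -- The case distinction moves into the input operator, so that `Strategy.sum_tr_run` applies.
  have h1 : ∀ m : Fin (t.val + 1) → Fin (N + 1), S.jointProb ρ t m =
      (tr (S.run t m (if ∃ s : Fin t, m s.castSucc = m (Fin.last t) then 0
        else ρ (m (Fin.last t))))).re := by
    intro m
    unfold Strategy.jointProb
    split_ifs
    · rw [← S.runLin_apply, map_zero, tr_zero, Complex.zero_re]
    · rfl
  unfold Strategy.prob
  simp only [h1]
  rw [← Complex.re_sum, S.sum_tr_run (Nat.le_of_lt_succ t.isLt), Complex.re_sum]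
  refine Finset.sum_congr rfl fun m _ => ?_
  have h2 : (∃ s : Fin t.val, m (Fin.castLE (Nat.succ_le_succ (Nat.le_of_lt_succ t.isLt))
      s.castSucc) = m (Fin.castLE (Nat.succ_le_succ (Nat.le_of_lt_succ t.isLt))
        (Fin.last t.val))) ↔ ¬ IsNewAt m t := by
    unfold IsNewAt
    push Not
    constructor
    · rintro ⟨s, hs⟩
      exact ⟨_, Fin.lt_def.2 s.isLt, hs⟩
    · rintro ⟨s, hst, hs⟩
      exact ⟨⟨s.val, hst⟩, hs⟩
  simp only [h2]
  by_cases h : IsNewAt m t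
  · simp only [h, not_true_eq_false, if_true, if_false]; rfl
  · simp only [h, not_false_eq_true, if_true, if_false]
    rw [← S.runLin_apply, map_zero, tr_zero, Complex.zero_re]

/-- A strategy that surely reaches the correct query costs as much as a family of positive
functionals with numberings. -/
theorem Strategy.exists_functionals {N : ℕ} (S : Strategy (N + 1) H)
    {ρ : Fin (N + 1) → Op H} (hρ : IsEnsemble ρ) (hS : S.Concludes ρ) (γ : Fin (N + 1) → ℝ) :
    ∃ (φ : (Fin (N + 1) → Fin (N + 1)) → Op H →ₗ[ℂ] ℂ)
      (ν : (Fin (N + 1) → Fin (N + 1)) → Equiv.Perm (Fin (N + 1))),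
      (∀ m (X : Op H), X.IsPositive → 0 ≤ φ m X) ∧ (∀ X, ∑ m, φ m X = tr X) ∧
      S.guesswork γ ρ = ∑ t, γ t * ∑ m, (φ m (ρ (ν m t))).re := by
  classical
  choose ν hν using fun m : Fin (N + 1) → Fin (N + 1) => exists_perm_eq_of_isNewAt m
  let φ : (Fin (N + 1) → Fin (N + 1)) → Op H →ₗ[ℂ] ℂ := fun m => trLin _ ∘ₗ S.runLin N m
  have hφ : ∀ m X, φ m X = tr (S.run N m X) := fun m X => by
    rw [← S.runLin_apply]; rfl
  have hpos : ∀ m (X : Op H), X.IsPositive → 0 ≤ φ m X := fun m X hX => by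
    rw [hφ]; exact tr_nonneg (S.isPositive_run N m hX)
  have hsum : ∀ X, ∑ m, φ m X = tr X := fun X => by
    simp only [hφ]; exact S.sum_tr_run_const N X
  refine ⟨φ, ν, hpos, hsum, ?_⟩
  have hre : ∀ m l, 0 ≤ (φ m (ρ l)).re := fun m l =>
    (Complex.nonneg_iff.1 (hpos m _ (hρ.nonneg l))).1
  let p : Fin (N + 1) → (Fin (N + 1) → Fin (N + 1)) → ℝ := fun t m =>
    if IsNewAt m t then (tr (S.run N m (ρ (m t)))).re else 0
  have hprob : ∀ t, S.prob ρ t = ∑ m, p t m := S.prob_eq ρ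
  have hle : ∀ t m, p t m ≤ (φ m (ρ (ν m t))).re := by
    intro t m
    by_cases h : IsNewAt m t
    · simp only [p, h, if_true, hν m t h, hφ, le_refl]
    · simp only [p, h, if_false, hre]
  have h1 : ∑ t, ∑ m, (φ m (ρ (ν m t))).re = 1 := by
    rw [Finset.sum_comm]
    have : ∀ m, ∑ t, (φ m (ρ (ν m t))).re = ∑ l, (φ m (ρ l)).re := fun m =>
      Equiv.sum_comp (ν m) fun l => (φ m (ρ l)).re
    simp only [this]
    rw [Finset.sum_comm]
    simp only [← Complex.re_sum, hsum, hρ.sum_trace, Complex.one_re]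
  have hS' : ∑ t, ∑ m, p t m = 1 := by
    simp only [← hprob]; exact hS
  -- Termwise inequality and equal totals force equality at each time, whatever the sign of `γ t`.
  have h2 : ∀ t, ∑ m, p t m = ∑ m, (φ m (ρ (ν m t))).re := by
    intro t
    exact (Finset.sum_eq_sum_iff_of_le fun t _ => Finset.sum_le_sum fun m _ => hle t m).1
      (hS'.trans h1.symm) t (Finset.mem_univ t)
  unfold Strategy.guesswork
  simp only [hprob, h2]

end Sequential

/-! ### Strategies that carry out a numbering-valued measurement -/

section MeasureAndPrepare

variable {H K : Type*} [NormedAddCommGroup H] [InnerProductSpace ℂ H] [CompleteSpace H]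
  [NormedAddCommGroup K] [InnerProductSpace ℂ K] [CompleteSpace K]

/-- Taking an entry of a matrix, as an additive map. -/
def matrixEntry {A : Type*} [AddMonoid A] {k : ℕ} (i j : Fin k) :
    CStarMatrix (Fin k) (Fin k) A →+ A where
  toFun M := M i j
  map_zero' := rfl
  map_add' _ _ := rfl

theorem matrixEntry_apply {A : Type*} [AddMonoid A] {k : ℕ} (i j : Fin k)
    (M : CStarMatrix (Fin k) (Fin k) A) : matrixEntry i j M = M i j := rfl

theorem inner_star_mul_apply (A B : Op H) (u : H) :
    inner ℂ u ((star A * B) u) = inner ℂ (A u) (B u) :=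
  ContinuousLinearMap.adjoint_inner_right A u (B u)

/-- Complete positivity of a vector state. It suffices to treat `star B * B`; inserting the
orthonormal basis `e` between the factors writes its image as a sum of `star C * C`, where `C` has
the entries `⟨e b, B i j u⟩ • p`. -/
theorem cstarMatrix_map_vectorState_nonneg [FiniteDimensional ℂ H] {k : ℕ}
    {M : CStarMatrix (Fin k) (Fin k) (Op H)} (hM : 0 ≤ M) (u : H) {p : Op K}
    (hp : IsStarProjection p) :
    0 ≤ M.map fun X : Op H => (inner ℂ u (X u) : ℂ) • p := by
  rw [StarOrderedRing.nonneg_iff] at hM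
  induction hM using AddSubmonoid.closure_induction with
  | zero =>
    refine le_of_eq ?_
    ext1
    simp
  | add M M' _ _ h h' =>
    convert add_nonneg h h' using 1
    ext1
    simp [add_smul]
  | mem M hM =>
    obtain ⟨B, rfl⟩ := hM
    let e := stdOrthonormalBasis ℂ H
    have key : (star B * B).map (fun X : Op H => (inner ℂ u (X u) : ℂ) • p) =
        ∑ b, star (B.map fun X : Op H => (inner ℂ (e b) (X u) : ℂ) • p) *
          (B.map fun X : Op H => (inner ℂ (e b) (X u) : ℂ) • p) := by
      ext1 i j
      have hpp : star p * p = p := by rw [hp.isSelfAdjoint.star_eq]; exact hp.isIdempotentElem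
      have h1 : ∀ r, inner ℂ u ((star (B r i) * B r j) u) =
          ∑ b, inner ℂ (B r i u) (e b) * inner ℂ (e b) (B r j u) := fun r => by
        rw [e.sum_inner_mul_inner, inner_star_mul_apply]
      have h2 : (∑ b, star (B.map fun X : Op H => (inner ℂ (e b) (X u) : ℂ) • p) *
          (B.map fun X : Op H => (inner ℂ (e b) (X u) : ℂ) • p)) i j =
          ∑ b, (star (B.map fun X : Op H => (inner ℂ (e b) (X u) : ℂ) • p) *
          (B.map fun X : Op H => (inner ℂ (e b) (X u) : ℂ) • p)) i j :=
        by
        simp only [← matrixEntry_apply, map_sum]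
      rw [h2]
      simp only [CStarMatrix.map_apply, CStarMatrix.mul_apply, CStarMatrix.star_apply, star_smul,
        smul_mul_smul_comm, hpp, _root_.sum_apply, inner_sum, h1, Finset.sum_smul]
      rw [Finset.sum_comm]
      simp
    rw [key]
    exact Finset.sum_nonneg fun b _ => star_mul_self_nonneg _

/-- The completely positive map that measures the positive operators `R i`, `i ∈ s`, and prepares
the projections `p i`. -/
def measurePrepare [FiniteDimensional ℂ H] {ι : Type*} (s : Finset ι) (R : ι → Op H)
    (hR : ∀ i, (R i).IsPositive) (p : ι → Op K) (hp : ∀ i, IsStarProjection (p i)) :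
    Op H →CP Op K where
  toLinearMap := ∑ i ∈ s, (trLin H ∘ₗ LinearMap.mulLeft ℂ (R i)).smulRight (p i)
  map_cstarMatrix_nonneg' k M hM := by
    choose d u hu using fun i => exists_tr_mul_eq_sum (hR i)
    have key : M.map ⇑(∑ i ∈ s, (trLin H ∘ₗ LinearMap.mulLeft ℂ (R i)).smulRight (p i)) =
        ∑ i ∈ s, ∑ l, M.map fun X : Op H => (inner ℂ (u i l) (X (u i l)) : ℂ) • p i := by
      ext1 i j
      have h2 : (∑ i ∈ s, ∑ l, M.map fun X : Op H =>
          (inner ℂ (u i l) (X (u i l)) : ℂ) • p i) i j = ∑ i' ∈ s, ∑ l,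
          (M.map fun X : Op H => (inner ℂ (u i' l) (X (u i' l)) : ℂ) • p i') i j := by
        simp only [← matrixEntry_apply, map_sum]
      rw [h2]
      simp [trLin_apply, hu, Finset.sum_smul]
    rw [key]
    exact Finset.sum_nonneg fun i _ => Finset.sum_nonneg fun l _ =>
      cstarMatrix_map_vectorState_nonneg hM _ (hp i)

theorem measurePrepare_apply [FiniteDimensional ℂ H] {ι : Type*} (s : Finset ι) (R : ι → Op H)
    (hR : ∀ i, (R i).IsPositive) (p : ι → Op K) (hp : ∀ i, IsStarProjection (p i)) (X : Op H) :
    measurePrepare s R hR p hp X = ∑ i ∈ s, tr (R i * X) • p i := by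
  change (∑ i ∈ s, (trLin H ∘ₗ LinearMap.mulLeft ℂ (R i)).smulRight (p i)) X = _
  rw [LinearMap.sum_apply]
  rfl

end MeasureAndPrepare

/-- The projection on a basis vector of the concrete Hilbert space. -/
def basisProj (d : ℕ) (i : Fin d) : Op (Q d) :=
  InnerProductSpace.rankOne ℂ (EuclideanSpace.single i 1) (EuclideanSpace.single i 1)

theorem isStarProjection_basisProj {d : ℕ} (i : Fin d) : IsStarProjection (basisProj d i) :=
  InnerProductSpace.isStarProjection_rankOne_self (by simp)

theorem isPositive_basisProj {d : ℕ} (i : Fin d) : (basisProj d i).IsPositive :=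
  InnerProductSpace.isPositive_rankOne_self _

theorem tr_basisProj {d : ℕ} (i : Fin d) : tr (basisProj d i) = 1 := by
  simp [basisProj, tr_rankOne]

theorem tr_basisProj_mul {d : ℕ} (i j : Fin d) :
    tr (basisProj d i * basisProj d j) = if i = j then 1 else 0 := by
  simp only [basisProj, tr_rankOne_mul, InnerProductSpace.rankOne_apply]
  by_cases h : i = j
  · subst h; simp
  · simp [h, EuclideanSpace.inner_single_left]

theorem sum_basisProj (d : ℕ) : ∑ i, basisProj d i = 1 := by
  have := (EuclideanSpace.basisFun (Fin d) ℂ).sum_rankOne_eq_id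
  simp only [EuclideanSpace.basisFun_apply] at this
  exact this

/-! ### The strategy with a classical register -/

section Attain

variable {H : Type*} [NormedAddCommGroup H] [InnerProductSpace ℂ H] [CompleteSpace H]
  [FiniteDimensional ℂ H]

/-- The instrument that measures `R`, announces the label `L i` of the outcome `i`, and keeps the
outcome in a register. -/
def registerInstrument {n d : ℕ} (R : Fin d → Op H) (hR : ∀ i, (R i).IsPositive)
    (hR1 : ∑ i, R i = 1) (L : Fin d → Fin n) : Instrument n H (Q d) where
  op k := measurePrepare (Finset.univ.filter fun i => L i = k) R hR (basisProj d)
    isStarProjection_basisProj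
  trace_preserving X := by
    simp only [measurePrepare_apply, tr_sum, tr_smul, tr_basisProj, mul_one]
    rw [Finset.sum_fiberwise, ← tr_sum, ← Finset.sum_mul, hR1, one_mul]

variable {N d : ℕ}

/-- The strategy that performs the measurement `R`, keeps its outcome in a register and then
queries in the order `ν i` that belongs to the outcome `i`. -/
def registerStrategy (R : Fin d → Op H) (hR : ∀ i, (R i).IsPositive) (hR1 : ∑ i, R i = 1)
    (ν : Fin d → Equiv.Perm (Fin (N + 1))) : Strategy (N + 1) H where
  dim _ := d
  first := registerInstrument R hR hR1 fun i => ν i 0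
  next t := registerInstrument (basisProj d) isPositive_basisProj (sum_basisProj d)
    -- Strategies are indexed by all natural numbers; the reduction modulo `N + 1` acts only after
    -- the last relevant step.
    fun i => ν i (Fin.ofNat (N + 1) (t + 1))

variable {R : Fin d → Op H} {hR : ∀ i, (R i).IsPositive} {hR1 : ∑ i, R i = 1}
  {ν : Fin d → Equiv.Perm (Fin (N + 1))}

/-- The register is diagonal in the measured basis, so later measurements do not disturb it; each
query only discards the outcomes whose order disagrees with the announced label. -/
theorem registerStrategy_run (t : ℕ) (m : Fin (t + 1) → Fin (N + 1)) (X : Op H) :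
    (registerStrategy R hR hR1 ν).run t m X =
      ∑ i with ∀ s : Fin (t + 1), ν i (Fin.ofNat (N + 1) s) = m s,
        tr (R i * X) • basisProj d i := by
  induction t with
  | zero =>
    change measurePrepare _ R hR (basisProj d) isStarProjection_basisProj X = _
    rw [measurePrepare_apply]
    refine Finset.sum_congr ?_ fun _ _ => rfl
    ext i
    simp only [Finset.mem_filter, Finset.mem_univ, true_and]
    exact ⟨fun h s => by rw [Fin.fin_one_eq_zero s]; exact h, fun h => h 0⟩
  | succ t ih =>
    refine (congrArg (measurePrepare (H := Q d) _ (basisProj d) isPositive_basisProj (basisProj d)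
      isStarProjection_basisProj) (ih fun s => m s.castSucc)).trans ?_
    rw [measurePrepare_apply]
    have h1 : ∀ j, tr (basisProj d j *
        ∑ i with ∀ s : Fin (t + 1), ν i (Fin.ofNat (N + 1) s) = m s.castSucc,
          tr (R i * X) • basisProj d i) =
        if ∀ s : Fin (t + 1), ν j (Fin.ofNat (N + 1) s) = m s.castSucc then tr (R j * X)
        else 0 := by
      intro j
      rw [Finset.mul_sum, tr_sum]
      simp only [mul_smul_comm, tr_smul, tr_basisProj_mul, mul_ite, mul_one, mul_zero,
        Finset.sum_ite_eq, Finset.mem_filter, Finset.mem_univ, true_and]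
    simp only [h1, ite_smul, zero_smul]
    rw [← Finset.sum_filter, Finset.filter_filter]
    refine Finset.sum_congr ?_ fun _ _ => rfl
    ext i
    simp only [Finset.mem_filter, Finset.mem_univ, true_and]
    rw [Fin.forall_fin_succ' (n := t + 1)]
    exact and_comm

theorem registerStrategy_tr_run (t : ℕ) (m : Fin (t + 1) → Fin (N + 1)) (X : Op H) :
    tr ((registerStrategy R hR hR1 ν).run t m X) =
      ∑ i with ∀ s : Fin (t + 1), ν i (Fin.ofNat (N + 1) s) = m s, tr (R i * X) := by
  refine (congrArg (tr (H := Q d)) (registerStrategy_run t m X)).trans ?_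
  simp only [tr_sum, tr_smul, tr_basisProj, mul_one]

theorem registerStrategy_prob (ρ : Fin (N + 1) → Op H) (t : Fin (N + 1)) :
    (registerStrategy R hR hR1 ν).prob ρ t = ∑ i, (tr (R i * ρ (ν i t))).re := by
  classical
  have hof : ∀ s : ℕ, s < N + 1 → (Fin.ofNat (N + 1) s).val = s := fun s hs =>
    Nat.mod_eq_of_lt hs
  have hlast : Fin.ofNat (N + 1) (Fin.last t.val).val = t := Fin.ext (hof t.val t.isLt)
  have h1 : ∀ m : Fin (t.val + 1) → Fin (N + 1),
      (registerStrategy R hR hR1 ν).jointProb ρ t m =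
      ∑ i, if m = (fun s => ν i (Fin.ofNat (N + 1) s.val)) then (tr (R i * ρ (ν i t))).re
        else 0 := by
    intro m
    unfold Strategy.jointProb
    split_ifs with h
    -- Each `ν i` is injective, so a sequence with a repeated label belongs to no outcome.
    · obtain ⟨s, hs⟩ := h
      rw [Finset.sum_eq_zero]
      intro i _
      rw [if_neg]
      rintro rfl
      have h2 := congrArg Fin.val ((ν i).injective hs)
      rw [hof _ (by have := s.isLt; have := t.isLt; simp; omega), hlast] at h2
      have := s.isLt
      simp at h2
      omega
    · rw [registerStrategy_tr_run, Complex.re_sum, Finset.sum_filter]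
      refine Finset.sum_congr rfl fun i _ => ?_
      by_cases hi : m = fun s => ν i (Fin.ofNat (N + 1) s.val)
      · rw [if_pos hi, if_pos (fun s => by rw [hi]), hi]
        simp only [hlast]
      · rw [if_neg hi, if_neg]
        exact fun hh => hi (funext fun s => (hh s).symm)
  unfold Strategy.prob
  simp only [h1]
  rw [Finset.sum_comm]
  simp

/-- Every numbering-valued measurement is carried out by a sequential strategy. -/
theorem exists_strategy_of_isNumberingMeasurement {ρ : Fin (N + 1) → Op H} (hρ : IsEnsemble ρ)
    {π : Equiv.Perm (Fin (N + 1)) → Op H} (hπ : IsNumberingMeasurement π)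
    (γ : Fin (N + 1) → ℝ) :
    ∃ S : Strategy (N + 1) H, S.Concludes ρ ∧ guesswork γ ρ π = S.guesswork γ ρ := by
  let e := Fintype.equivFin (Equiv.Perm (Fin (N + 1)))
  obtain ⟨S, hprob⟩ : ∃ S : Strategy (N + 1) H, ∀ t, S.prob ρ t =
      ∑ i, (tr (π (e.symm i) * ρ (e.symm i t))).re :=
    ⟨_, registerStrategy_prob (R := fun i => π (e.symm i)) (hR := fun i => hπ.nonneg _)
      (hR1 := (Equiv.sum_comp e.symm π).trans hπ.sum_eq_one) (ν := fun i => e.symm i) ρ⟩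
  have hsum : ∀ t, ∑ i, (tr (π (e.symm i) * ρ (e.symm i t))).re =
      ∑ ν, (tr (π ν * ρ (ν t))).re := fun t =>
    Equiv.sum_comp e.symm fun ν => (tr (π ν * ρ (ν t))).re
  refine ⟨S, ?_, ?_⟩
  rotate_left
  · unfold Strategy.guesswork
    simp only [hprob, hsum]
    rfl
  · unfold Strategy.Concludes
    simp only [hprob, hsum]
    rw [Finset.sum_comm]
    have : ∀ ν : Equiv.Perm (Fin (N + 1)), ∑ t, (tr (π ν * ρ (ν t))).re =
        ∑ m, (tr (π ν * ρ m)).re := fun ν => Equiv.sum_comp ν fun m => (tr (π ν * ρ m)).re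
    simp only [this, ← Complex.re_sum, ← tr_sum, ← Finset.mul_sum]
    rw [← Finset.sum_mul, hπ.sum_eq_one, one_mul, tr_sum, hρ.sum_trace, Complex.one_re]

end Attain

/-! ### Optimality of the benevolent numbering -/

section Optimal

variable {H : Type*} [NormedAddCommGroup H] [InnerProductSpace ℂ H] [CompleteSpace H]
  [FiniteDimensional ℂ H]

/-- The Pauli vector of `effOp` is `2 * r` times the cost-weighted sum of vertices. Its squared
length is the quadratic assignment functional of the inverse numbering, up to a factor independent
of the numbering. -/
theorem radius_effOp_le_bvNumbering (hH : Module.finrank ℂ H = 2) {n : ℕ} {γ : Fin n → ℝ}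
    {h : ℝ} {ρ : Fin n → Op H} (hγ : Monotone γ) (h0 : 0 ≤ h) (hb : h ≤ heightBound n)
    (hρ : IsAntiprismEnsemble h ρ) (ν : Equiv.Perm (Fin n)) :
    radius (effOp γ ρ ν) ≤ radius (effOp γ ρ (bvNumbering n)) := by
  obtain ⟨s, hs, r, hr, hv⟩ := hρ.vertices
  have key : ∀ ν : Equiv.Perm (Fin n), (tr (effOp γ ρ ν * effOp γ ρ ν)).re =
      (2 * r) ^ 2 * assignValue (fun t => γ t - avg γ) (antiprismKernel n h) ν.symm := by
    intro ν
    rw [tr_mul_self_eq_sum_pauliVec hH hs (isSelfAdjoint_effOp hρ.ensemble.nonneg ν)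
      (tr_effOp hρ.uniform ν), ← sum_sq_weighted_vertices, Finset.mul_sum]
    refine Finset.sum_congr rfl fun k _ => ?_
    rw [← mul_pow]
    congr 1
    have h1 : ∀ m, (tr (ρ m * s k)).re = r * antiprismVertex n h m k := fun m =>
      congrFun (hv m) k
    unfold pauliVec effOp
    rw [smul_mul_assoc, tr_smul, Finset.sum_mul, tr_sum]
    simp only [smul_mul_assoc, tr_smul]
    rw [show (2 : ℂ) = ((2 : ℝ) : ℂ) by norm_num, Complex.re_ofReal_mul, Complex.re_sum]
    simp only [Complex.re_ofReal_mul, h1]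
    simp only [Finset.mul_sum]
    exact Finset.sum_congr rfl fun t _ => by ring
  unfold radius
  rw [key, key]
  have hmono : Monotone fun t => γ t - avg γ := fun a b hab => sub_le_sub_right (hγ hab) _
  have := assignValue_le_zigzag hmono (antiprismKernel_isCyclicDecreasing h0 hb) ν.symm
  gcongr

variable {n : ℕ} {γ : Fin n → ℝ} {σ : Equiv.Perm (Fin n)} {ρ : Fin n → Op H} {c : ℂ}

open Classical in
theorem optMeasurement_eq (hH : Module.finrank ℂ H = 2) (hρ : IsEnsemble ρ)
    (hc : ∀ m, tr (ρ m) = c) (νstar ν : Equiv.Perm (Fin n)) :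
    optMeasurement γ σ ρ νstar ν =
      if ν = νstar ∨ ν = νstar * σ then halfSpace (effOp γ ρ ν) else 0 := by
  unfold optMeasurement
  rw [projNeg_add_half_projNull hH (isSelfAdjoint_effOp hρ.nonneg ν) (tr_effOp hc ν)]

/-- As `σ` is not the identity, the two numberings differ and contribute one term each. -/
theorem sum_optMeasurement (hH : Module.finrank ℂ H = 2) (hσ1 : σ ≠ 1) (hρ : IsEnsemble ρ)
    (hc : ∀ m, tr (ρ m) = c) (νstar : Equiv.Perm (Fin n))
    {M : Type*} [AddCommMonoid M] (f : Equiv.Perm (Fin n) → Op H → M) (hf : ∀ ν, f ν 0 = 0) :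
    ∑ ν, f ν (optMeasurement γ σ ρ νstar ν) =
      f νstar (halfSpace (effOp γ ρ νstar)) +
        f (νstar * σ) (halfSpace (effOp γ ρ (νstar * σ))) := by
  classical
  have hne : νstar ≠ νstar * σ := fun h => hσ1 (by simpa using h)
  rw [← Finset.sum_subset (Finset.subset_univ {νstar, νstar * σ}), Finset.sum_pair hne]
  · simp only [optMeasurement_eq hH hρ hc, true_or, or_true, if_true]
  · intro ν _ hν
    simp only [Finset.mem_insert, Finset.mem_singleton] at hν
    rw [optMeasurement_eq hH hρ hc, if_neg hν, hf]

theorem isNumberingMeasurement_optMeasurement (hH : Module.finrank ℂ H = 2)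
    (hσ : IsBalancedBy γ σ) (hσ1 : σ ≠ 1) (hρ : IsEnsemble ρ) (hc : ∀ m, tr (ρ m) = c)
    (νstar : Equiv.Perm (Fin n)) : IsNumberingMeasurement (optMeasurement γ σ ρ νstar) where
  nonneg ν := by
    classical
    rw [optMeasurement_eq hH hρ hc]
    split_ifs
    · exact isPositive_halfSpace hH (isSelfAdjoint_effOp hρ.nonneg ν) (tr_effOp hc ν)
    · exact ContinuousLinearMap.isPositive_zero
  sum_eq_one := by
    rw [sum_optMeasurement hH hσ1 hρ hc νstar (fun _ X => X) fun _ => rfl,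
      effOp_mul_of_isBalancedBy hσ, halfSpace_add_halfSpace_neg]

/-- The functional `X ↦ Tr (A X)`. -/
def trMul (A : Op H) : Op H →ₗ[ℂ] ℂ := trLin H ∘ₗ LinearMap.mulLeft ℂ A

theorem trMul_apply (A X : Op H) : trMul A X = tr (A * X) := rfl

theorem IsNumberingMeasurement.sum_trMul {π : Equiv.Perm (Fin n) → Op H}
    (hπ : IsNumberingMeasurement π) (X : Op H) : ∑ ν, trMul (π ν) X = tr X := by
  simp only [trMul_apply]
  rw [← tr_sum, ← Finset.sum_mul, hπ.sum_eq_one, one_mul]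

theorem guesswork_optMeasurement (hH : Module.finrank ℂ H = 2)
    (hσ : IsBalancedBy γ σ) (hσ1 : σ ≠ 1) (hρ : IsEnsemble ρ) (hc : ∀ m, tr (ρ m) = c)
    (νstar : Equiv.Perm (Fin n)) :
    guesswork γ ρ (optMeasurement γ σ ρ νstar) = avg γ - radius (effOp γ ρ νstar) := by
  have hπ := isNumberingMeasurement_optMeasurement hH hσ hσ1 hρ hc νstar
  have h1 := cost_eq_avg_add (γ := γ) hρ.sum_trace hπ.sum_trMul id
  have h2 := sum_optMeasurement (γ := γ) hH hσ1 hρ hc νstar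
    (fun ν X => (tr (X * effOp γ ρ ν)).re) (fun ν => by rw [zero_mul, tr_zero, Complex.zero_re])
  have hE := isSelfAdjoint_effOp (γ := γ) hρ.nonneg νstar
  have hE0 := tr_effOp (γ := γ) hc νstar
  rw [effOp_mul_of_isBalancedBy hσ, tr_halfSpace_mul hE hE0,
    tr_halfSpace_mul hE.neg (by rw [tr_neg, hE0, neg_zero]), radius_neg] at h2
  refine Eq.trans h1 ?_
  simp only [trMul_apply, id_eq]
  rw [h2]
  simp only [Complex.neg_re, Complex.ofReal_re]
  ring

theorem optMeasurement_bvNumbering_optimal (hH : Module.finrank ℂ H = 2) {h : ℝ}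
    (hγ : Monotone γ) (hσ : IsBalancedBy γ σ) (hσ1 : σ ≠ 1) (h0 : 0 ≤ h)
    (hb : h ≤ heightBound n) (hρ : IsAntiprismEnsemble h ρ) :
    IsNumberingMeasurement (optMeasurement γ σ ρ (bvNumbering n)) ∧
    IsMinGuesswork γ ρ (guesswork γ ρ (optMeasurement γ σ ρ (bvNumbering n))) ∧
    ∀ π : Equiv.Perm (Fin n) → Op H, IsNumberingMeasurement π →
      guesswork γ ρ (optMeasurement γ σ ρ (bvNumbering n)) ≤ guesswork γ ρ π := by
  have hπ := isNumberingMeasurement_optMeasurement hH hσ hσ1 hρ.ensemble hρ.uniform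
    (bvNumbering n)
  have hval := guesswork_optMeasurement hH hσ hσ1 hρ.ensemble hρ.uniform (bvNumbering n)
  have hle := radius_effOp_le_bvNumbering hH hγ h0 hb hρ
  obtain ⟨N, rfl⟩ : ∃ N, n = N + 1 := by
    cases n with
    | zero => exact absurd (Subsingleton.elim σ 1) hσ1
    | succ N => exact ⟨N, rfl⟩
  refine ⟨hπ, ⟨exists_strategy_of_isNumberingMeasurement hρ.ensemble hπ γ, ?_⟩, ?_⟩
  · rintro x ⟨S, hS, rfl⟩
    obtain ⟨φ, ν, hφ0, hφ, hcost⟩ := S.exists_functionals hρ.ensemble hS γ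
    rw [hval, hcost]
    exact avg_sub_le_cost hH hρ.ensemble hρ.uniform hφ0 hφ ν fun m => hle _
  · intro π hπ'
    rw [hval]
    exact avg_sub_le_cost hH hρ.ensemble hρ.uniform
      (fun ν X hX => tr_mul_nonneg (hπ'.nonneg ν) hX) hπ'.sum_trMul id fun ν => hle _

end Optimal

/-! ### Recognizing antiprism ensembles by their overlaps -/

section Frame

variable {H : Type*} [NormedAddCommGroup H] [InnerProductSpace ℂ H] [CompleteSpace H]
  [FiniteDimensional ℂ H]

/-- Two orthonormal traceless Hermitian operators on a qubit can be completed. -/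
theorem exists_isPauliBasis (hH : Module.finrank ℂ H = 2) {a b : Op H} (ha : IsSelfAdjoint a)
    (hb : IsSelfAdjoint b) (ha0 : tr a = 0) (hb0 : tr b = 0) (haa : tr (a * a) = 1)
    (hbb : tr (b * b) = 1) (hab : tr (a * b) = 0) : ∃ c, IsPauliBasis ![a, b, c] := by
  have hanti : b * a = -(a * b) := by
    have := mul_add_mul_of_tr_eq_zero hH ha0 hb0
    rw [hab, zero_smul] at this
    exact eq_neg_of_add_eq_zero_right this
  have ha2 := mul_self_of_tr_eq_zero hH ha0
  have hb2 := mul_self_of_tr_eq_zero hH hb0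
  rw [haa] at ha2
  rw [hbb] at hb2
  -- Since `a` and `b` anticommute, `a * b` is anti-Hermitian and an imaginary factor makes it
  -- Hermitian. Since `a * a = b * b = 1 / 2`, the trace of `(a * b) ^ 2` is `-1 / 2`, and `z ^ 2 =
  -- -2` normalizes it.
  set z : ℂ := -(Complex.I * (√2 : ℝ)) with hz
  have hzz : z * z = -2 := by
    have h1 : ((√2 : ℝ) : ℂ) * (√2 : ℝ) = 2 := by
      rw [← Complex.ofReal_mul, Real.mul_self_sqrt (by norm_num)]; norm_num
    rw [hz]
    linear_combination (Complex.I * Complex.I) * h1 + 2 * Complex.I_mul_I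
  have hac : tr (a * (z • (a * b))) = 0 := by
    rw [mul_smul_comm, ← mul_assoc, ha2, smul_mul_assoc, one_mul, tr_smul, tr_smul, hb0]
    simp
  have hbc : tr (b * (z • (a * b))) = 0 := by
    rw [tr_mul_comm, smul_mul_assoc, mul_assoc, hb2, mul_smul_comm, mul_one, tr_smul, tr_smul,
      ha0]
    simp
  have hcc : tr ((z • (a * b)) * (z • (a * b))) = 1 := by
    have h1 : a * b * (a * b) = -(a * a * (b * b)) := by
      rw [mul_assoc, ← mul_assoc b a b, hanti]; noncomm_ring
    rw [smul_mul_smul_comm, h1, ha2, hb2, smul_mul_smul_comm, one_mul, tr_smul, tr_neg, tr_smul,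
      tr_one hH, hzz]
    norm_num
  refine ⟨z • (a * b), ⟨?_, ?_, ?_⟩⟩
  · intro k
    fin_cases k
    · exact ha
    · exact hb
    · change star (z • (a * b)) = z • (a * b)
      rw [star_smul, star_mul, ha.star_eq, hb.star_eq, hanti, smul_neg, ← neg_smul]
      congr 1
      simp [hz]
  · intro k
    fin_cases k
    · exact ha0
    · exact hb0
    · change tr (z • (a * b)) = 0
      rw [tr_smul, hab, mul_zero]
  · intro k l
    fin_cases k <;> fin_cases l
    · simpa using haa
    · simpa using hab
    · simpa using hac
    · simpa using (tr_mul_comm b a).trans hab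
    · simpa using hbb
    · simpa using hbc
    · simpa using (tr_mul_comm (z • (a * b)) a).trans hac
    · simpa using (tr_mul_comm (z • (a * b)) b).trans hbc
    · simpa using hcc

/-- A family of Hermitian operators with the Gram matrix of the vectors `v` has the vectors `v` as
its coordinates in an orthonormal basis, if the vectors form a tight frame in their span. -/
theorem exists_isPauliBasis_of_gram (hH : Module.finrank ℂ H = 2) {n : ℕ} {R : Fin n → Op H}
    (hR : ∀ m, IsSelfAdjoint (R m)) (hR0 : ∀ m, tr (R m) = 0) {v : Fin n → Fin 3 → ℝ}
    (hRR : ∀ i j, tr (R i * R j) = ((v i ⬝ᵥ v j : ℝ) : ℂ)) {D : Fin 3 → ℝ}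
    (hD : ∀ k l, ∑ m, v m k * v m l = if k = l then D k else 0) (hD0 : D 0 ≠ 0)
    (hD1 : D 1 ≠ 0) : ∃ s, IsPauliBasis s ∧ ∀ m, pauliVec s (R m) = v m := by
  -- The frame condition says that `∑ m, v m (v m)ᵀ` is diagonal with entries `D`, so these sums
  -- recover the coordinate axes.
  let s : Fin 3 → Op H := fun k => ∑ m, ((v m k / D k : ℝ) : ℂ) • R m
  have hs : ∀ k, IsSelfAdjoint (s k) := fun k =>
    isSelfAdjoint_sum _ fun m _ => isSelfAdjoint_ofReal_smul (hR m) _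
  have hs0 : ∀ k, tr (s k) = 0 := fun k => by
    simp only [s, tr_sum, tr_smul, hR0, mul_zero, Finset.sum_const_zero]
  have hRs : ∀ m k, D k ≠ 0 → tr (R m * s k) = ((v m k : ℝ) : ℂ) := by
    intro m k hk
    have h1 : ∑ j, v j k / D k * (v m ⬝ᵥ v j) = v m k := by
      simp only [dotProduct, Finset.mul_sum]
      rw [Finset.sum_comm]
      have : ∀ l, ∑ j, v j k / D k * (v m l * v j l) = v m l / D k * ∑ j, v j k * v j l :=
        fun l => by
          rw [Finset.mul_sum]
          exact Finset.sum_congr rfl fun j _ => by ring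
      simp only [this, hD, mul_ite, mul_zero, Finset.sum_ite_eq, Finset.mem_univ, if_true]
      field_simp
    rw [← h1]
    simp only [s, Finset.mul_sum, tr_sum, mul_smul_comm, tr_smul, hRR]
    push_cast
    rfl
  have hss : ∀ k l, D k ≠ 0 → D l ≠ 0 → tr (s k * s l) = if k = l then 1 else 0 := by
    intro k l hk hl
    have h1 : ∑ m, v m k / D k * v m l = if k = l then 1 else 0 := by
      have : ∑ m, v m k / D k * v m l = (∑ m, v m k * v m l) / D k := by
        rw [Finset.sum_div]
        exact Finset.sum_congr rfl fun j _ => by ring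
      rw [this, hD]
      split_ifs
      · field_simp
      · simp
    have h2 : tr (s k * s l) = ((∑ m, v m k / D k * v m l : ℝ) : ℂ) := by
      conv_lhs => rw [show s k = ∑ m, ((v m k / D k : ℝ) : ℂ) • R m from rfl]
      simp only [Finset.sum_mul, tr_sum, smul_mul_assoc, tr_smul, hRs _ l hl]
      push_cast
      rfl
    rw [h2, h1]
    split_ifs <;> simp
  by_cases hD2 : D 2 = 0
  · have hv2 : ∀ m, v m 2 = 0 := by
      have h1 := hD 2 2
      rw [if_pos rfl, hD2, Finset.sum_eq_zero_iff_of_nonneg fun m _ => mul_self_nonneg _] at h1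
      exact fun m => mul_self_eq_zero.1 (h1 m (Finset.mem_univ m))
    obtain ⟨c, hc⟩ := exists_isPauliBasis hH (hs 0) (hs 1) (hs0 0) (hs0 1)
      (by simpa using hss 0 0 hD0 hD0) (by simpa using hss 1 1 hD1 hD1)
      (by simpa using hss 0 1 hD0 hD1)
    refine ⟨_, hc, fun m => ?_⟩
    have e0 : pauliVec ![s 0, s 1, c] (R m) 0 = v m 0 := by
      simp [pauliVec, hRs m 0 hD0]
    have e1 : pauliVec ![s 0, s 1, c] (R m) 1 = v m 1 := by
      simp [pauliVec, hRs m 1 hD1]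
    -- In the planar case the first two coordinates exhaust the norm, and Parseval forces the third
    -- to vanish.
    have e2 := tr_mul_self_eq_sum_pauliVec hH hc (hR m) (hR0 m)
    rw [hRR, Complex.ofReal_re, Fin.sum_univ_three, e0, e1, dotProduct, Fin.sum_univ_three,
      hv2] at e2
    funext k
    fin_cases k
    · exact e0
    · exact e1
    · have e3 : pauliVec ![s 0, s 1, c] (R m) 2 ^ 2 = 0 := by linarith
      exact (pow_eq_zero_iff two_ne_zero |>.1 e3).trans (hv2 m).symm
  · have hDk : ∀ k, D k ≠ 0 := by
      intro k
      fin_cases k <;> assumption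
    refine ⟨s, ⟨hs, hs0, fun k l => hss k l (hDk k) (hDk l)⟩, fun m => ?_⟩
    funext k
    simp [pauliVec, hRs m k (hDk k)]

/-- Pure states with the overlaps of the states on a polygon or an antiprism. -/
theorem isAntiprismEnsemble_of_overlap (hH : Module.finrank ℂ H = 2) {n : ℕ} (hn : n ≠ 0)
    {h : ℝ} {ψ : Fin n → H} {ρ : Fin n → Op H} (hψ : ∀ m, ‖ψ m‖ = 1)
    (hρ : ∀ m, ρ m = (1 / (n : ℂ)) • InnerProductSpace.rankOne ℂ (ψ m) (ψ m))
    (hov : ∀ i j, ‖inner ℂ (ψ i) (ψ j)‖ ^ 2 =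
      (1 + antiprismKernel n h (gap i j) / (1 + h ^ 2)) / 2) {D : Fin 3 → ℝ}
    (hD : ∀ k l, ∑ m, antiprismVertex n h m k * antiprismVertex n h m l =
      if k = l then D k else 0) (hD0 : D 0 ≠ 0) (hD1 : D 1 ≠ 0) :
    IsAntiprismEnsemble h ρ := by
  have hnC : (n : ℂ) ≠ 0 := by exact_mod_cast hn
  have hnR : (n : ℝ) ≠ 0 := by exact_mod_cast hn
  have htr : ∀ m, tr (ρ m) = 1 / (n : ℂ) := fun m => by
    rw [hρ, tr_smul, tr_rankOne, inner_self_eq_norm_sq_to_K, hψ]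
    simp
  have hpos : ∀ m, (ρ m).IsPositive := fun m => by
    rw [hρ]
    refine (InnerProductSpace.isPositive_rankOne_self _).smul_of_nonneg ?_
    rw [show (1 / (n : ℂ)) = ((1 / (n : ℝ) : ℝ) : ℂ) by push_cast; rfl, Complex.zero_le_real]
    positivity
  refine ⟨⟨hpos, ?_⟩, htr, ?_⟩
  · simp only [htr, Finset.sum_const, Finset.card_univ, Fintype.card_fin, nsmul_eq_mul]
    field_simp
  -- The traceless part of a pure state of weight `1 / n` has squared norm `1 / (2 * n ^ 2)`, while
  -- a vertex has squared length `1 + h ^ 2`.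
  set r : ℝ := √(1 / (2 * n ^ 2 * (1 + h ^ 2))) with hr
  have hrr : r ^ 2 = 1 / (2 * n ^ 2 * (1 + h ^ 2)) := Real.sq_sqrt (by positivity)
  have hr0 : r ≠ 0 := (Real.sqrt_pos.2 (by positivity)).ne'
  set R : Fin n → Op H := fun m => ρ m - ((1 / (2 * n) : ℝ) : ℂ) • 1 with hRdef
  have htrρ : ∀ i j, tr (ρ i * ρ j) = ((1 / n ^ 2 * ‖inner ℂ (ψ i) (ψ j)‖ ^ 2 : ℝ) : ℂ) := by
    intro i j
    rw [hρ i, hρ j, smul_mul_smul_comm, tr_smul, tr_rankOne_mul,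
      InnerProductSpace.rankOne_apply, inner_smul_right,
      ← inner_conj_symm (ψ j) (ψ i), Complex.conj_mul']
    push_cast
    field_simp
  have hRR : ∀ i j, tr (R i * R j) = (((r • antiprismVertex n h i) ⬝ᵥ
      (r • antiprismVertex n h j) : ℝ) : ℂ) := by
    intro i j
    have h1 : tr (R i * R j) = tr (ρ i * ρ j) - 1 / (2 * n ^ 2) := by
      simp only [hRdef, sub_mul, mul_sub, tr_sub, smul_mul_assoc, mul_smul_comm, tr_smul, one_mul,
        mul_one, tr_one hH, htr]
      push_cast
      field_simp
      ring
    rw [h1, htrρ, hov, smul_dotProduct, dotProduct_smul, smul_eq_mul, smul_eq_mul,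
      antiprismVertex_dotProduct, ← mul_assoc, ← sq, hrr]
    have : (1 + h ^ 2 : ℝ) ≠ 0 := by positivity
    have : (1 + (h : ℂ) ^ 2) ≠ 0 := by exact_mod_cast this
    push_cast
    field_simp
    ring
  obtain ⟨s, hs, hsv⟩ := exists_isPauliBasis_of_gram hH (R := R)
    (v := fun m => r • antiprismVertex n h m) (D := fun k => r ^ 2 * D k)
    (fun m => (hpos m).isSelfAdjoint.sub (isSelfAdjoint_ofReal_smul (IsSelfAdjoint.one _) _))
    (fun m => by
      simp only [hRdef, tr_sub, tr_smul, htr, tr_one hH]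
      push_cast
      field_simp
      ring)
    hRR
    (fun k l => by
      have : ∀ m, (r • antiprismVertex n h m) k * (r • antiprismVertex n h m) l =
          r ^ 2 * (antiprismVertex n h m k * antiprismVertex n h m l) := fun m => by
        simp only [Pi.smul_apply, smul_eq_mul]; ring
      simp only [this, ← Finset.mul_sum, hD, mul_ite, mul_zero])
    (mul_ne_zero (pow_ne_zero _ hr0) hD0) (mul_ne_zero (pow_ne_zero _ hr0) hD1)
  refine ⟨s, hs, r, Real.sqrt_nonneg _, fun m => ?_⟩
  rw [← antiprismVertex, ← hsv m]
  funext k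
  simp only [pauliVec, hRdef, sub_mul, tr_sub, smul_mul_assoc, one_mul, tr_smul, hs.traceless,
    mul_zero, sub_zero]

end Frame

/-! ### SIC and MUB ensembles -/

section Vertices

theorem cos_two_pi_div_three : Real.cos (2 * Real.pi / 3) = -(1 / 2) := by
  rw [show 2 * Real.pi / 3 = Real.pi - Real.pi / 3 by ring, Real.cos_pi_sub,
    Real.cos_pi_div_three]

theorem sin_two_pi_div_three : Real.sin (2 * Real.pi / 3) = √3 / 2 := by
  rw [show 2 * Real.pi / 3 = Real.pi - Real.pi / 3 by ring, Real.sin_pi_sub,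
    Real.sin_pi_div_three]

theorem cos_four_pi_div_three : Real.cos (4 * Real.pi / 3) = -(1 / 2) := by
  rw [show 4 * Real.pi / 3 = Real.pi / 3 + Real.pi by ring, Real.cos_add_pi,
    Real.cos_pi_div_three]

theorem sin_four_pi_div_three : Real.sin (4 * Real.pi / 3) = -(√3 / 2) := by
  rw [show 4 * Real.pi / 3 = Real.pi / 3 + Real.pi by ring, Real.sin_add_pi,
    Real.sin_pi_div_three]

theorem cos_five_pi_div_three : Real.cos (5 * Real.pi / 3) = 1 / 2 := by
  rw [show 5 * Real.pi / 3 = 2 * Real.pi - Real.pi / 3 by ring, Real.cos_two_pi_sub,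
    Real.cos_pi_div_three]

theorem sin_five_pi_div_three : Real.sin (5 * Real.pi / 3) = -(√3 / 2) := by
  rw [show 5 * Real.pi / 3 = 2 * Real.pi - Real.pi / 3 by ring, Real.sin_two_pi_sub,
    Real.sin_pi_div_three]

theorem cos_three_pi_div_two : Real.cos (3 * Real.pi / 2) = 0 := by
  rw [show 3 * Real.pi / 2 = Real.pi / 2 + Real.pi by ring, Real.cos_add_pi,
    Real.cos_pi_div_two, neg_zero]

theorem sin_three_pi_div_two : Real.sin (3 * Real.pi / 2) = -1 := by
  rw [show 3 * Real.pi / 2 = Real.pi / 2 + Real.pi by ring, Real.sin_add_pi,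
    Real.sin_pi_div_two]

theorem antiprismVertex_three : antiprismVertex 3 0 =
    ![![1, 0, 0], ![-(1 / 2), √3 / 2, 0], ![-(1 / 2), -(√3 / 2), 0]] := by
  funext m
  fin_cases m
  · simp [antiprismVertex]
  · simp [antiprismVertex, cos_two_pi_div_three, sin_two_pi_div_three]
  · have : 2 * Real.pi * 2 / 3 = 4 * Real.pi / 3 := by ring
    simp [antiprismVertex, this, cos_four_pi_div_three, sin_four_pi_div_three]

theorem antiprismVertex_four (h : ℝ) : antiprismVertex 4 h =
    ![![1, 0, h], ![0, 1, -h], ![-1, 0, h], ![0, -1, -h]] := by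
  funext m
  fin_cases m
  · simp [antiprismVertex]
  · have : 2 * Real.pi / 4 = Real.pi / 2 := by ring
    simp [antiprismVertex, this]
  · have : 2 * Real.pi * 2 / 4 = Real.pi := by ring
    simp [antiprismVertex, this]
  · have : 2 * Real.pi * 3 / 4 = 3 * Real.pi / 2 := by ring
    simp [antiprismVertex, this, cos_three_pi_div_two, sin_three_pi_div_two, pow_succ]

theorem antiprismVertex_six (h : ℝ) : antiprismVertex 6 h =
    ![![1, 0, h], ![1 / 2, √3 / 2, -h], ![-(1 / 2), √3 / 2, h], ![-1, 0, -h],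
      ![-(1 / 2), -(√3 / 2), h], ![1 / 2, -(√3 / 2), -h]] := by
  funext m
  fin_cases m
  · simp [antiprismVertex]
  · have : 2 * Real.pi / 6 = Real.pi / 3 := by ring
    simp [antiprismVertex, this]
  · have : 2 * Real.pi * 2 / 6 = 2 * Real.pi / 3 := by ring
    simp [antiprismVertex, this, cos_two_pi_div_three, sin_two_pi_div_three]
  · have : 2 * Real.pi * 3 / 6 = Real.pi := by ring
    simp [antiprismVertex, this, pow_succ]
  · have : 2 * Real.pi * 4 / 6 = 4 * Real.pi / 3 := by ring
    simp [antiprismVertex, this, cos_four_pi_div_three, sin_four_pi_div_three, pow_succ]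
  · have : 2 * Real.pi * 5 / 6 = 5 * Real.pi / 3 := by ring
    simp [antiprismVertex, this, cos_five_pi_div_three, sin_five_pi_div_three, pow_succ]

theorem one_div_sqrt_two_sq : (1 / √2 : ℝ) ^ 2 = 1 / 2 := by
  rw [div_pow, Real.sq_sqrt (by norm_num)]; norm_num

theorem antiprismKernel_three {d : ℕ} (hd : d < 3) :
    antiprismKernel 3 0 d = if d = 0 then 1 else -(1 / 2) := by
  have : 2 * Real.pi * 2 / 3 = 4 * Real.pi / 3 := by ring
  interval_cases d <;>
    norm_num [antiprismKernel, this, cos_two_pi_div_three, cos_four_pi_div_three]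

theorem antiprismKernel_four {h : ℝ} {d : ℕ} (hd : d < 4) :
    antiprismKernel 4 h d =
      if d = 0 then 1 + h ^ 2 else if d = 2 then -1 + h ^ 2 else -h ^ 2 := by
  have e1 : 2 * Real.pi / 4 = Real.pi / 2 := by ring
  have e2 : 2 * Real.pi * 2 / 4 = Real.pi := by ring
  have e3 : 2 * Real.pi * 3 / 4 = 3 * Real.pi / 2 := by ring
  interval_cases d <;> simp [antiprismKernel, e1, e2, e3, cos_three_pi_div_two, pow_succ]

theorem antiprismKernel_six {d : ℕ} (hd : d < 6) :
    antiprismKernel 6 (1 / √2) d = if d = 0 then 3 / 2 else if d = 3 then -(3 / 2) else 0 := by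
  have e1 : 2 * Real.pi / 6 = Real.pi / 3 := by ring
  have e2 : 2 * Real.pi * 2 / 6 = 2 * Real.pi / 3 := by ring
  have e3 : 2 * Real.pi * 3 / 6 = Real.pi := by ring
  have e4 : 2 * Real.pi * 4 / 6 = 4 * Real.pi / 3 := by ring
  have e5 : 2 * Real.pi * 5 / 6 = 5 * Real.pi / 3 := by ring
  unfold antiprismKernel
  rw [one_div_sqrt_two_sq]
  interval_cases d <;> norm_num [e1, e2, e3, e4, e5, cos_two_pi_div_three,
    cos_four_pi_div_three, cos_five_pi_div_three]

theorem heightBound_four : heightBound 4 = 1 / √2 := by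
  have h1 : ¬ Odd 4 := by decide
  have h2 : Even (4 / 2) := by decide
  have e1 : 2 * Real.pi / 4 = Real.pi / 2 := by ring
  rw [heightBound, if_neg h1, if_pos h2]
  simp [e1]

theorem heightBound_six : heightBound 6 = 1 / √2 := by
  have h1 : ¬ Odd 6 := by decide
  have h2 : ¬ Even (6 / 2) := by decide
  have e1 : 2 * Real.pi / 6 = Real.pi / 3 := by ring
  have e2 : 4 * Real.pi / 6 = 2 * Real.pi / 3 := by ring
  rw [heightBound, if_neg h1, if_neg h2]
  norm_num [e1, e2, cos_two_pi_div_three]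

theorem heightBound_nonneg (n : ℕ) : 0 ≤ heightBound n := by
  unfold heightBound
  split_ifs
  · exact le_rfl
  · exact Real.sqrt_nonneg _
  · exact Real.sqrt_nonneg _

theorem gap_eq_zero_iff {n : ℕ} (x y : Fin n) : gap x y = 0 ↔ x = y := by
  rw [Fin.ext_iff]; unfold gap; omega

theorem gap_lt {n : ℕ} (x y : Fin n) : gap x y < n := by
  unfold gap; omega

theorem frame_three (k l : Fin 3) :
    ∑ m, antiprismVertex 3 0 m k * antiprismVertex 3 0 m l =
      if k = l then ![3 / 2, 3 / 2, 0] k else 0 := by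
  have h3 : √3 * √3 = (3 : ℝ) := Real.mul_self_sqrt (by norm_num)
  rw [antiprismVertex_three, Fin.sum_univ_three]
  fin_cases k <;> fin_cases l <;> simp <;> linarith

theorem frame_four (h : ℝ) (k l : Fin 3) :
    ∑ m, antiprismVertex 4 h m k * antiprismVertex 4 h m l =
      if k = l then ![2, 2, 4 * h ^ 2] k else 0 := by
  rw [antiprismVertex_four, Fin.sum_univ_four]
  fin_cases k <;> fin_cases l <;> simp <;> ring

theorem frame_six (h : ℝ) (k l : Fin 3) :
    ∑ m, antiprismVertex 6 h m k * antiprismVertex 6 h m l =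
      if k = l then ![3, 3, 6 * h ^ 2] k else 0 := by
  have h3 : √3 * √3 = (3 : ℝ) := Real.mul_self_sqrt (by norm_num)
  rw [antiprismVertex_six, Fin.sum_univ_six]
  fin_cases k <;> fin_cases l <;> simp <;> linarith

end Vertices

theorem IsMutuallyUnbiased.overlap {H : Type*} [NormedAddCommGroup H]
    [InnerProductSpace ℂ H] {k : ℕ} {ψ : Fin k × Fin 2 → H} (hψ : IsMutuallyUnbiased ψ) (p q : Fin k × Fin 2) :
    ‖inner ℂ (ψ p) (ψ q)‖ ^ 2 = if p = q then 1 else if p.1 = q.1 then 0 else 1 / 2 := by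
  obtain ⟨a, i⟩ := p
  obtain ⟨b, j⟩ := q
  by_cases hab : a = b
  · subst hab
    have := (orthonormal_iff_ite.1 (hψ.1 a)) i j
    rw [this]
    by_cases hij : i = j <;> simp [hij]
  · rw [hψ.2 a b hab]
    simp [hab]

/-! ### The four ensembles recognized by their overlaps -/

section Ensembles

variable {H : Type*} [NormedAddCommGroup H] [InnerProductSpace ℂ H] [CompleteSpace H]
  [FiniteDimensional ℂ H]

theorem IsRealSIC.isAntiprismEnsemble (hH : Module.finrank ℂ H = 2) {ρ : Fin 3 → Op H}
    (hρ : IsRealSIC ρ) : IsAntiprismEnsemble 0 ρ := by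
  obtain ⟨ψ, -, ⟨hψ, hρψ⟩, hov⟩ := hρ
  refine isAntiprismEnsemble_of_overlap hH (by norm_num) hψ (by simpa using hρψ) ?_ frame_three
    (by simp) (by simp)
  intro i j
  rw [antiprismKernel_three (gap_lt i j)]
  by_cases hij : i = j
  · subst hij
    simp [gap, inner_self_eq_norm_sq_to_K, hψ]
  · rw [hov i j hij, if_neg (by rwa [gap_eq_zero_iff])]
    norm_num

/-- At `h ^ 2 = 1 / 2` the kernel equals `-1 / 2` at all nonzero distances: the antiprism is a
regular tetrahedron, and any order of the states fits. -/
theorem IsComplexSIC.isAntiprismEnsemble (hH : Module.finrank ℂ H = 2) {ρ : Fin 4 → Op H}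
    (hρ : IsComplexSIC ρ) : IsAntiprismEnsemble (1 / √2) ρ := by
  obtain ⟨ψ, ⟨hψ, hρψ⟩, hov⟩ := hρ
  refine isAntiprismEnsemble_of_overlap hH (by norm_num) hψ (by simpa using hρψ) ?_
    (frame_four _) (by simp) (by simp)
  intro i j
  rw [antiprismKernel_four (gap_lt i j), one_div_sqrt_two_sq]
  by_cases hij : i = j
  · subst hij
    norm_num [gap, inner_self_eq_norm_sq_to_K, hψ]
  · rw [hov i j hij, if_neg (by rwa [gap_eq_zero_iff])]
    split_ifs <;> norm_num

/-- An order of two bases in which the Bloch vectors form a square. -/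
def squareEquiv : Fin 4 ≃ Fin 2 × Fin 2 where
  toFun := ![(0, 0), (1, 0), (0, 1), (1, 1)]
  invFun p := ![![0, 2], ![1, 3]] p.1 p.2
  left_inv := by decide
  right_inv := by decide

/-- An order of three bases in which the Bloch vectors form a triangular antiprism. -/
def octahedronEquiv : Fin 6 ≃ Fin 3 × Fin 2 where
  toFun := ![(0, 0), (2, 1), (1, 0), (0, 1), (2, 0), (1, 1)]
  invFun p := ![![0, 3], ![2, 5], ![4, 1]] p.1 p.2
  left_inv := by decide
  right_inv := by decide

theorem squareEquiv_fst_eq_iff (i j : Fin 4) :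
    (squareEquiv i).1 = (squareEquiv j).1 ↔ gap i j = 0 ∨ gap i j = 2 := by
  revert i j; decide

theorem octahedronEquiv_fst_eq_iff (i j : Fin 6) :
    (octahedronEquiv i).1 = (octahedronEquiv j).1 ↔ gap i j = 0 ∨ gap i j = 3 := by
  revert i j; decide

theorem IsRealMUB.isAntiprismEnsemble (hH : Module.finrank ℂ H = 2) {ρ : Fin 2 × Fin 2 → Op H}
    (hρ : IsRealMUB ρ) : IsAntiprismEnsemble 0 fun m => ρ (squareEquiv m) := by
  obtain ⟨ψ, -, ⟨hψ, hρψ⟩, hov⟩ := hρ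
  refine isAntiprismEnsemble_of_overlap hH (by norm_num) (ψ := fun m => ψ (squareEquiv m))
    (fun m => hψ _) (fun m => by simpa using hρψ _) ?_ (frame_four _) (by simp) (by simp)
  intro i j
  rw [antiprismKernel_four (gap_lt i j), hov.overlap]
  simp only [squareEquiv.injective.eq_iff, squareEquiv_fst_eq_iff]
  simp only [← gap_eq_zero_iff]
  split_ifs <;> first | omega | norm_num

/-- At `h ^ 2 = 1 / 2` the kernel vanishes except at distances `0` and `3`: the antiprism is a
regular octahedron, whose antipodal vertices carry the two states of one basis. -/
theorem IsComplexMUB.isAntiprismEnsemble (hH : Module.finrank ℂ H = 2)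
    {ρ : Fin 3 × Fin 2 → Op H} (hρ : IsComplexMUB ρ) :
    IsAntiprismEnsemble (1 / √2) fun m => ρ (octahedronEquiv m) := by
  obtain ⟨ψ, ⟨hψ, hρψ⟩, hov⟩ := hρ
  refine isAntiprismEnsemble_of_overlap hH (by norm_num) (ψ := fun m => ψ (octahedronEquiv m))
    (fun m => hψ _) (fun m => by simpa using hρψ _) ?_ (frame_six _) (by simp) (by simp)
  intro i j
  rw [antiprismKernel_six (gap_lt i j), hov.overlap, one_div_sqrt_two_sq]
  simp only [octahedronEquiv.injective.eq_iff, octahedronEquiv_fst_eq_iff]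
  simp only [← gap_eq_zero_iff]
  split_ifs <;> first | omega | norm_num

end Ensembles

end Guesswork

end

theorem mainTheorem5 {H : Type*} [NormedAddCommGroup H] [InnerProductSpace ℂ H]
    [CompleteSpace H] [FiniteDimensional ℂ H] (hH : Module.finrank ℂ H = 2) :
    (∀ (n : ℕ) (γ : Fin n → ℝ) (σ : Equiv.Perm (Fin n)) (h : ℝ) (ρ : Fin n → Guesswork.Op H),
      Monotone γ → Guesswork.IsBalancedBy γ σ → σ ≠ 1 →
      0 ≤ h → h ≤ Guesswork.heightBound n → Guesswork.IsAntiprismEnsemble h ρ →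
      Guesswork.IsNumberingMeasurement
        (Guesswork.optMeasurement γ σ ρ (Guesswork.bvNumbering n)) ∧
      Guesswork.IsMinGuesswork γ ρ
        (Guesswork.guesswork γ ρ
          (Guesswork.optMeasurement γ σ ρ (Guesswork.bvNumbering n))) ∧
      ∀ π : Equiv.Perm (Fin n) → Guesswork.Op H, Guesswork.IsNumberingMeasurement π →
        Guesswork.guesswork γ ρ (Guesswork.optMeasurement γ σ ρ (Guesswork.bvNumbering n)) ≤
          Guesswork.guesswork γ ρ π) ∧
    (∀ ρ : Fin 3 → Guesswork.Op H, Guesswork.IsRealSIC ρ →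
      Guesswork.IsAntiprismEnsemble 0 ρ ∧ 0 ≤ Guesswork.heightBound 3) ∧
    (∀ ρ : Fin 2 × Fin 2 → Guesswork.Op H, Guesswork.IsRealMUB ρ →
      (∃ e : Fin 4 ≃ Fin 2 × Fin 2, Guesswork.IsAntiprismEnsemble 0 (fun m => ρ (e m))) ∧
        0 ≤ Guesswork.heightBound 4) ∧
    (∀ ρ : Fin 4 → Guesswork.Op H, Guesswork.IsComplexSIC ρ →
      Guesswork.IsAntiprismEnsemble (1 / √2) ρ ∧ 1 / √2 = Guesswork.heightBound 4) ∧
    (∀ ρ : Fin 3 × Fin 2 → Guesswork.Op H, Guesswork.IsComplexMUB ρ →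
      (∃ e : Fin 6 ≃ Fin 3 × Fin 2,
        Guesswork.IsAntiprismEnsemble (1 / √2) (fun m => ρ (e m))) ∧
        1 / √2 = Guesswork.heightBound 6) := by
  refine ⟨fun n γ σ h ρ hγ hσ hσ1 h0 hb hρ =>
      Guesswork.optMeasurement_bvNumbering_optimal hH hγ hσ hσ1 h0 hb hρ,
    fun ρ hρ => ⟨hρ.isAntiprismEnsemble hH, Guesswork.heightBound_nonneg 3⟩,
    fun ρ hρ => ⟨⟨_, hρ.isAntiprismEnsemble hH⟩, Guesswork.heightBound_nonneg 4⟩,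
    fun ρ hρ => ⟨hρ.isAntiprismEnsemble hH, Guesswork.heightBound_four.symm⟩,
    fun ρ hρ => ⟨⟨_, hρ.isAntiprismEnsemble hH⟩, Guesswork.heightBound_six.symm⟩⟩
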